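/- **Model.** A weighted graph on a finite set $V$ of $n$ vertices is a symmetric matrix $W\in[0,1]^{V\times V}$ with $W_{v,v}=1$ for all $v$; its edges are the pairs $u\neq v$ with $W_{u,v}>0$, and $W_{u,v}$ is the weight of the edge. For $\theta\in\mathbb R^V$ put $u_v(\theta)=\sum_{v'}W_{v,v'}\theta_{v'}$, and let $$\mathsf{OPT}^{\mathsf{IR}}=\min\{\|\theta\|_1:\ \theta\in[0,1]^V,\ u_v(\theta)\ge 1\ \text{for all } v\in V\}.$$ There are $n$ agents; their types form a uniformly random bijection $t:\{1,\dots,n\}\to V$. A signaling scheme with finite signal space $\mathbb S\subset[0,1]$ assigns to each $t$ a probability distribution $\varphi(t)$ on $\mathbb S^V$; signals $s\sim\varphi(t)$ are drawn and agent $i$ is privately told $s_{t_i}$. It is ternary if $|\mathbb S|=3$ (not all three values need actually be sent). It is persuasive if for every agent $i$ and every $\theta\in\mathbb S$ which agent $i$ receives with positive probability, $$\theta=\min\{x\ge 0:\ \mathbb E[\,u_{t_i}(x,s_{-t_i})\mid s_{t_i}=\theta\,]\ge 1\},$$ where $(x,s_{-t_i})$ is $s$ with the coordinate $t_i$ replaced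 by $x$; in particular, effort $\theta$ is feasible in conditional expectation. Its cost is $\mathbb E_{t,\,s\sim\varphi(t)}\|s\|_1$. **Theorem.** There are universal constants $C,c>0$ such that the following hold. 1. Every weighted graph on $n$ vertices has a persuasive ternary signaling scheme of cost at most $C\,n^{3/4}(\mathsf{OPT}^{\mathsf{IR}})^{1/2}$. 2. If $0<\delta\le 1$ and every edge of the graph has weight at least $\delta$, it has a persuasive ternary signaling scheme of cost at most $C\,(n\cdot\mathsf{OPT}^{\mathsf{IR}})^{2/3}\,\delta^{-1/3}$. 3. The $n^{2/3}$ ratio is tight for $\delta=1/2$: for every integer $k\ge 2$, let $G_k$ be the graph on $n=k^3+2$ vertices consisting of two centers and $k^2$ disjoint cliques of size $k$, where each center is adjacent to every other vertex (in particular to the other center) and every edge has weight $1/2$. Then $\mathsf{OPT}^{\mathsf{IR}}=2$ on $G_k$, and every persuasive signaling scheme on $G_k$, with any finite signal space in $[0,1]$, has cost at least $c\,n^{2/3}$. -/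

import Mathlib

universe u

noncomputable section

/-- A weighted graph on the set `V` of task types, given by its symmetric coefficient matrix with
entries in `[0, 1]` and unit diagonal.  The edges are the pairs `u ≠ v` with `weight u v > 0`. -/
structure WeightedGraph (V : Type u) where
  weight : V → V → ℝ
  symm : ∀ u v, weight u v = weight v u
  self_eq_one : ∀ v, weight v v = 1
  nonneg : ∀ u v, 0 ≤ weight u v
  le_one : ∀ u v, weight u v ≤ 1

/-- `{u, v}` is an edge of the graph. -/
def WeightedGraph.IsEdge {V : Type u} (G : WeightedGraph V) (u v : V) : Prop :=
  u ≠ v ∧ 0 < G.weight u v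

/-- Every edge of the graph has weight at least `δ`. -/
def WeightedGraph.EdgeWeightsAtLeast {V : Type u} (G : WeightedGraph V) (δ : ℝ) : Prop :=
  ∀ u v, G.IsEdge u v → δ ≤ G.weight u v

/-- The `ℓ¹` norm of a vector indexed by task types (the total workload). -/
def l1Norm {V : Type u} [Fintype V] (θ : V → ℝ) : ℝ := ∑ v, |θ v|

/-- The total contribution `u_v(θ) = ∑_{v'} W_{v,v'} θ_{v'}` entering task `v`. -/
def WeightedGraph.contribution {V : Type u} [Fintype V] (G : WeightedGraph V)
    (θ : V → ℝ) (v : V) : ℝ :=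
  ∑ v', G.weight v v' * θ v'

/-- Feasible and individually rational contribution vectors. -/
def WeightedGraph.feasibleIR {V : Type u} [Fintype V] (G : WeightedGraph V) : Set (V → ℝ) :=
  {θ | (∀ v, 1 ≤ G.contribution θ v) ∧ (∀ v, 0 ≤ θ v) ∧ (∀ v, θ v ≤ 1)}

/-- The benchmark `OPT^IR`: the least workload of a feasible, individually rational solution. -/
def WeightedGraph.optIR {V : Type u} [Fintype V] (G : WeightedGraph V) : ℝ :=
  sInf (l1Norm '' G.feasibleIR)

/-- The infimum defining `OPT^IR` is a minimum. -/
theorem WeightedGraph.optIR_isLeast {V : Type u} [Fintype V] (G : WeightedGraph V) :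
    IsLeast (l1Norm '' G.feasibleIR) G.optIR := by
  have hsub : G.feasibleIR ⊆ Set.Icc (fun _ => (0 : ℝ)) (fun _ => 1) :=
    fun θ h => ⟨fun v => h.2.1 v, fun v => h.2.2 v⟩
  have hclosed : IsClosed G.feasibleIR := by
    have h1 : G.feasibleIR = (⋂ v, {θ : V → ℝ | 1 ≤ G.contribution θ v}) ∩
        ((⋂ v, {θ : V → ℝ | 0 ≤ θ v}) ∩ (⋂ v, {θ : V → ℝ | θ v ≤ 1})) := by
      ext θ
      simp [WeightedGraph.feasibleIR]
    rw [h1]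
    refine (isClosed_iInter fun v => ?_).inter
      ((isClosed_iInter fun v => ?_).inter (isClosed_iInter fun v => ?_))
    · refine isClosed_le continuous_const ?_
      unfold WeightedGraph.contribution
      fun_prop
    · exact isClosed_le continuous_const (continuous_apply v)
    · exact isClosed_le (continuous_apply v) continuous_const
  have hcompact : IsCompact G.feasibleIR := isCompact_Icc.of_isClosed_subset hclosed hsub
  have hne : G.feasibleIR.Nonempty := by
    refine ⟨fun _ => 1, fun v => ?_, fun v => zero_le_one, fun v => le_rfl⟩
    have h2 := Finset.single_le_sum (f := fun v' => G.weight v v' * (1 : ℝ))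
      (fun v' _ => by simpa using G.nonneg v v') (Finset.mem_univ v)
    simpa [WeightedGraph.contribution, G.self_eq_one] using h2
  have hcont : Continuous (l1Norm : (V → ℝ) → ℝ) := by
    unfold l1Norm
    fun_prop
  exact (hcompact.image hcont).isLeast_sInf (hne.image _)

/-- A type profile: a bijection that assigns to each of the `n = |V|` agents a task type. -/
abbrev TypeProfile (V : Type u) [Fintype V] : Type u := Fin (Fintype.card V) ≃ V

/-- The uniform prior on type profiles. -/
def prior {V : Type u} [Fintype V] [DecidableEq V] (_t : TypeProfile V) : ℝ :=
  1 / (Fintype.card (TypeProfile V) : ℝ)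

/-- A signaling scheme with finite signal space `S`: it maps each type profile to a joint
distribution of the signals `(s_v)_{v ∈ V}`, where `s_v` is sent to the agent of type `v`. -/
abbrev SignalingScheme (V : Type u) [Fintype V] [DecidableEq V] (S : Finset ℝ) : Type u :=
  TypeProfile V → stdSimplex ℝ (V → S)

namespace SignalingScheme

variable {V : Type u} [Fintype V] [DecidableEq V] {S : Finset ℝ}

/-- The probability that agent `i` receives the signal `θ`. -/
def receiveProb (φ : SignalingScheme V S) (i : Fin (Fintype.card V)) (θ : S) : ℝ :=
  ∑ t : TypeProfile V, ∑ s : V → S, if s (t i) = θ then prior t * φ t s else 0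

/-- The posterior belief of agent `i` about the type profile and the signals, given that the agent
received the signal `θ`.  It is meaningful when `θ` is received with positive probability. -/
def posterior (φ : SignalingScheme V S) (i : Fin (Fintype.card V)) (θ : S)
    (t : TypeProfile V) (s : V → S) : ℝ :=
  if s (t i) = θ then prior t * φ t s / φ.receiveProb i θ else 0

/-- The posterior expectation of the quality `u_{t_i}(x, s_{-t_i})` of agent `i`, who received `θ`
and exerts effort `x`, while all other agents follow their signals. -/
def expectedQuality (G : WeightedGraph V) (φ : SignalingScheme V S)
    (i : Fin (Fintype.card V)) (θ : S) (x : ℝ) : ℝ :=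
  ∑ t : TypeProfile V, ∑ s : V → S, φ.posterior i θ t s *
    G.contribution (Function.update (fun v => (s v : ℝ)) (t i) x) (t i)

/-- Persuasiveness: whenever an agent receives a signal `θ`, effort `θ` is feasible in posterior
expectation (feasibility) and is the least such effort (stability). -/
def IsPersuasive (G : WeightedGraph V) (φ : SignalingScheme V S) : Prop :=
  ∀ (i : Fin (Fintype.card V)) (θ : S), 0 < φ.receiveProb i θ →
    1 ≤ φ.expectedQuality G i θ (θ : ℝ) ∧
    IsLeast {x : ℝ | 0 ≤ x ∧ 1 ≤ φ.expectedQuality G i θ x} (θ : ℝ)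

/-- The cost: the expected total contribution when all agents follow their signals. -/
def cost (φ : SignalingScheme V S) : ℝ :=
  ∑ t : TypeProfile V, prior t * ∑ s : V → S, φ t s * l1Norm (fun v => (s v : ℝ))

end SignalingScheme

/-- There is a persuasive ternary signaling scheme, that is, one whose signal space consists of
three values in `[0, 1]`, of cost at most `B`. -/
def WeightedGraph.HasPersuasiveTernaryScheme {V : Type u} [Fintype V] [DecidableEq V]
    (G : WeightedGraph V) (B : ℝ) : Prop :=
  ∃ (S : Finset ℝ) (φ : SignalingScheme V S), (S : Set ℝ) ⊆ Set.Icc 0 1 ∧ S.card = 3 ∧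
    φ.IsPersuasive G ∧ φ.cost ≤ B

/-- Two centers, and `k ^ 2` groups of `k` leaves each. -/
abbrev CenterCliqueVertex (k : ℕ) : Type := Fin 2 ⊕ (Fin (k ^ 2) × Fin k)

/-- Two vertices are linked if one of them is a center or if both are leaves of the same group. -/
def CenterCliqueVertex.Linked {k : ℕ} : CenterCliqueVertex k → CenterCliqueVertex k → Prop
  | .inl _, _ => True
  | .inr _, .inl _ => True
  | .inr x, .inr y => x.1 = y.1

theorem CenterCliqueVertex.linked_comm {k : ℕ} (u v : CenterCliqueVertex k) :
    Linked u v ↔ Linked v u := by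
  rcases u with a | x <;> rcases v with b | y <;> simp [Linked, eq_comm]

open Classical in
/-- The graph with two centers, each adjacent to every other vertex, and `k ^ 2` disjoint cliques
of `k` leaves each, in which every edge has weight `1 / 2`. -/
def centerCliqueGraph (k : ℕ) : WeightedGraph (CenterCliqueVertex k) where
  weight u v := if u = v then 1 else if CenterCliqueVertex.Linked u v then 1 / 2 else 0
  symm u v := by simp only [eq_comm, CenterCliqueVertex.linked_comm u v]
  self_eq_one v := by simp
  nonneg u v := by split_ifs <;> norm_num
  le_one u v := by split_ifs <;> norm_num

end

/-!
The excess of a signal is the expectation of `u_v(s) - 1` over the vertices that receive it. The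
posterior expected quality is affine in the own effort with slope `1`, so that a scheme is
persuasive iff the excess of every positive signal is zero and that of the signal `0` is
nonnegative (`SignalingScheme.isPersuasive_iff`).

**Upper bounds.** Schemes that ignore the type profile suffice. Write `n` for the number of
vertices, `m` for the sum of all weights, `O` for `OPT^IR` and `K` for the target cost. Telling
everyone the effort `n / m` is persuasive at cost `n ^ 2 / m ≤ n`, so one may assume `m * K ≤ n ^ 2`
and `16 * K ≤ n`. Then three phases are mixed, with signals `0`, `l` and `h = 1 - ε`, `ε = K / n`.
* The signal `h` goes to a sample `X` of an optimal fractional solution. The receivers have an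
  excess of at most `O ^ 2`, the others a deficit of at most `ε * n + O`.
* To balance `h`, it is sometimes sent to a set in which it has a deficit. For edge weights at least
  `δ` this is an independent set, of size at least `δ * n ^ 2 / (4 * m)`; for general weights
  it is a random set of density `K / (2 * m)`. The required frequency is `O(ε)`.
  If the signal has no positive excess to begin with, `ε` is decreased until it is balanced.
* To make up for the resulting deficit of order `K` at the signal `0`, sometimes the vertices
  outside of a sample `X` receive `l`, at least of order `n / m`, and those in `X` receive `0`. The
  latter are adjacent to essentially the whole graph, and their excess is comparable to the cost
  of this phase.

The signal `l` is balanced by its definition. The expected excesses are multi-affine in the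
indicators of a sample, and so are evaluated by substituting the probabilities
(`WeightedGraph.sum_bernoulliWeight_mul_quadratic`); the phases are put together in
`WeightedGraph.hasPersuasiveTernaryScheme_of_phases`.

**Lower bound.** Weighting the excesses by `f(s_v)`, where `f 0 ≤ 0`, gives a nonpositive
expectation. For two centers and `k ^ 2` cliques of size `k`, the choice
`f x = k * x - 2 + (k ^ 2 / 8) * [x ≥ 1 - 1 / (4 * k)]` makes four times the total effort plus the
weighted excess at least `k ^ 2 / 16` for every single vector of efforts
(`CenterCliqueVertex.pointwise_bound`). The affine part forces the total effort `C` of the centers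
to be within `O(1 / k)` of `2` or else costs enough; if `C` is that close to `2`, both centers
receive signals to which leaves contribute almost no deficit, and the jump of `f` detects
their excess.
-/

noncomputable section

/-! ### Persuasiveness in terms of excesses -/

namespace WeightedGraph

variable {V : Type u} [Fintype V] [DecidableEq V]

theorem contribution_update_self (G : WeightedGraph V) (s : V → ℝ) (v : V) (x : ℝ) :
    G.contribution (Function.update s v x) v = G.contribution s v - s v + x := by
  unfold contribution
  rw [← Finset.add_sum_erase _ _ (Finset.mem_univ v),
    ← Finset.add_sum_erase (a := v) _ (fun v' => G.weight v v' * s v') (Finset.mem_univ v)]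
  have : ∑ v' ∈ Finset.univ.erase v, G.weight v v' * Function.update s v x v' =
      ∑ v' ∈ Finset.univ.erase v, G.weight v v' * s v' :=
    Finset.sum_congr rfl fun v' hv' => by
      rw [Function.update_of_ne (Finset.ne_of_mem_erase hv')]
  rw [this, G.self_eq_one, Function.update_self]
  ring

end WeightedGraph

namespace SignalingScheme

variable {V : Type u} [Fintype V] [DecidableEq V] {S : Finset ℝ}

theorem prior_pos (t : TypeProfile V) : 0 < prior t := by
  have : 0 < Fintype.card (TypeProfile V) := Fintype.card_pos_iff.mpr ⟨t⟩
  unfold prior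
  positivity

theorem sum_prior : ∑ t : TypeProfile V, prior t = 1 := by
  have : Nonempty (TypeProfile V) := ⟨(Fintype.equivFin V).symm⟩
  simp [prior, Finset.card_univ]

/-- The type profile being uniform, the type of each agent is uniform on `V`. -/
theorem sum_prior_mul (i : Fin (Fintype.card V)) (g : V → ℝ) :
    (Fintype.card V : ℝ) * ∑ t : TypeProfile V, prior t * g (t i) = ∑ v, g v := by
  have hsymm : ∀ j, ∑ t : TypeProfile V, prior t * g (t j) =
      ∑ t : TypeProfile V, prior t * g (t i) := fun j =>
    Fintype.sum_equiv (Equiv.equivCongr (Equiv.swap i j) (Equiv.refl V)) _ _ fun t => by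
      simp [prior]
  calc (Fintype.card V : ℝ) * ∑ t : TypeProfile V, prior t * g (t i)
      = ∑ j : Fin (Fintype.card V), ∑ t : TypeProfile V, prior t * g (t j) := by
        simp [hsymm]
    _ = ∑ t : TypeProfile V, prior t * ∑ j, g (t j) := by
        rw [Finset.sum_comm]
        simp [Finset.mul_sum]
    _ = ∑ v, g v := by
        simp_rw [fun t : TypeProfile V => Equiv.sum_comp t g]
        rw [← Finset.sum_mul, sum_prior, one_mul]

/-- The unnormalized excess quality at the signal `θ`: the expectation of `u_{t_i}(s) - 1` over
the event that agent `i` receives `θ`. -/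
def excess (G : WeightedGraph V) (φ : SignalingScheme V S) (i : Fin (Fintype.card V))
    (θ : S) : ℝ :=
  ∑ t : TypeProfile V, ∑ s : V → S,
    if s (t i) = θ then prior t * φ t s * (G.contribution (fun v => (s v : ℝ)) (t i) - 1) else 0

theorem weight_nonneg (φ : SignalingScheme V S) (i : Fin (Fintype.card V)) (θ : S)
    (t : TypeProfile V) (s : V → S) : 0 ≤ if s (t i) = θ then prior t * φ t s else 0 := by
  split_ifs
  · exact mul_nonneg (prior_pos t).le ((φ t).2.1 s)
  · exact le_rfl

theorem receiveProb_nonneg (φ : SignalingScheme V S) (i : Fin (Fintype.card V)) (θ : S) :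
    0 ≤ φ.receiveProb i θ :=
  Finset.sum_nonneg fun t _ => Finset.sum_nonneg fun s _ => φ.weight_nonneg i θ t s

theorem excess_eq_zero_of_receiveProb_eq_zero (G : WeightedGraph V) (φ : SignalingScheme V S)
    (i : Fin (Fintype.card V)) (θ : S) (h : φ.receiveProb i θ = 0) : φ.excess G i θ = 0 := by
  refine Finset.sum_eq_zero fun t _ => Finset.sum_eq_zero fun s _ => ?_
  have h1 := (Finset.sum_eq_zero_iff_of_nonneg fun t _ =>
    Finset.sum_nonneg fun s _ => φ.weight_nonneg i θ t s).1 h t (Finset.mem_univ t)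
  have h2 := (Finset.sum_eq_zero_iff_of_nonneg fun s _ => φ.weight_nonneg i θ t s).1 h1 s
    (Finset.mem_univ s)
  split_ifs at h2 ⊢
  · rw [h2, zero_mul]
  · rfl

/-- The posterior expected quality is affine in the own effort, with slope `1`. -/
theorem expectedQuality_eq (G : WeightedGraph V) (φ : SignalingScheme V S)
    (i : Fin (Fintype.card V)) (θ : S) (x : ℝ) (h : 0 < φ.receiveProb i θ) :
    φ.expectedQuality G i θ x = 1 + φ.excess G i θ / φ.receiveProb i θ + (x - θ) := by
  have key : φ.receiveProb i θ * φ.expectedQuality G i θ x =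
      φ.excess G i θ + φ.receiveProb i θ * (1 + (x - θ)) := by
    conv_rhs => rw [receiveProb]
    unfold excess expectedQuality
    rw [Finset.mul_sum, Finset.sum_mul, ← Finset.sum_add_distrib]
    refine Finset.sum_congr rfl fun t _ => ?_
    rw [Finset.mul_sum, Finset.sum_mul, ← Finset.sum_add_distrib]
    refine Finset.sum_congr rfl fun s _ => ?_
    unfold posterior
    split_ifs with hs
    · rw [G.contribution_update_self, hs]
      field_simp
      ring
    · ring
  field_simp
  linarith

/-- A scheme is persuasive iff the positive signals have no excess, and the signal `0` has a
nonnegative one. -/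
theorem isPersuasive_iff (G : WeightedGraph V) (φ : SignalingScheme V S)
    (hS : (S : Set ℝ) ⊆ Set.Icc 0 1) :
    φ.IsPersuasive G ↔ ∀ i θ, 0 ≤ φ.excess G i θ ∧ (0 < (θ : ℝ) → φ.excess G i θ = 0) := by
  constructor
  · intro hφ i θ
    rcases (φ.receiveProb_nonneg i θ).eq_or_lt with h0 | h0
    · simp [φ.excess_eq_zero_of_receiveProb_eq_zero G i θ h0.symm]
    obtain ⟨h1, h2⟩ := hφ i θ h0
    have hθ := (hS θ.2).1
    rw [φ.expectedQuality_eq G i θ _ h0] at h1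
    have hE : 0 ≤ φ.excess G i θ / φ.receiveProb i θ := by linarith
    refine ⟨by simpa [div_nonneg_iff, h0.le, h0.not_ge] using hE, fun hpos => ?_⟩
    -- otherwise a slightly smaller effort would still be feasible
    have hmem : max 0 ((θ : ℝ) - φ.excess G i θ / φ.receiveProb i θ) ∈
        {x : ℝ | 0 ≤ x ∧ 1 ≤ φ.expectedQuality G i θ x} := by
      refine ⟨le_max_left _ _, ?_⟩
      rw [φ.expectedQuality_eq G i θ _ h0]
      linarith [le_max_right 0 ((θ : ℝ) - φ.excess G i θ / φ.receiveProb i θ)]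
    have h3 := h2.2 hmem
    have h4 : φ.excess G i θ / φ.receiveProb i θ = 0 := by
      rcases le_max_iff.1 h3 with h | h <;> linarith
    exact (div_eq_zero_iff.1 h4).resolve_right h0.ne'
  · intro hφ i θ h0
    obtain ⟨h1, h2⟩ := hφ i θ
    have hE := div_nonneg h1 h0.le
    have hθ := (hS θ.2).1
    refine ⟨?_, ⟨hθ, ?_⟩, ?_⟩
    · rw [φ.expectedQuality_eq G i θ _ h0]; linarith
    · rw [φ.expectedQuality_eq G i θ _ h0]; linarith
    · rintro x ⟨hx0, hx⟩
      rcases hθ.eq_or_lt with h | h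
      · rw [← h]; exact hx0
      · rw [φ.expectedQuality_eq G i θ _ h0, h2 h, zero_div] at hx
        linarith

/-- The excesses of a persuasive scheme, weighted by a function `f` of the signal with `f 0 ≤ 0`,
have a nonpositive sum. The sign of `f` at positive signals is free, as these have no excess. This
is the only consequence of persuasiveness that the lower bound uses. -/
theorem IsPersuasive.sum_test_nonpos {G : WeightedGraph V} {φ : SignalingScheme V S}
    (hφ : φ.IsPersuasive G) (hS : (S : Set ℝ) ⊆ Set.Icc 0 1) (f : ℝ → ℝ) (hf : f 0 ≤ 0) :
    ∑ t : TypeProfile V, prior t * ∑ s : V → S, φ t s *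
      ∑ v, f (s v) * (G.contribution (fun v => (s v : ℝ)) v - 1) ≤ 0 := by
  have heq : ∑ t : TypeProfile V, prior t * ∑ s : V → S, φ t s *
      ∑ v, f (s v) * (G.contribution (fun v => (s v : ℝ)) v - 1) =
      ∑ i, ∑ θ : S, f θ * φ.excess G i θ := by
    calc _ = ∑ t : TypeProfile V, ∑ s : V → S, ∑ i, prior t * φ t s *
          (f (s (t i)) * (G.contribution (fun v => (s v : ℝ)) (t i) - 1)) := by
          refine Finset.sum_congr rfl fun t _ => ?_
          rw [Finset.mul_sum]
          refine Finset.sum_congr rfl fun s _ => ?_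
          rw [← Equiv.sum_comp t, ← mul_assoc, Finset.mul_sum]
      _ = ∑ t : TypeProfile V, ∑ s : V → S, ∑ i, ∑ θ : S, f θ * (if s (t i) = θ then
          prior t * φ t s * (G.contribution (fun v => (s v : ℝ)) (t i) - 1) else 0) := by
          refine Finset.sum_congr rfl fun t _ => Finset.sum_congr rfl fun s _ =>
            Finset.sum_congr rfl fun i _ => ?_
          simp only [mul_ite, mul_zero, Finset.sum_ite_eq, Finset.mem_univ, if_true]
          ring
      _ = _ := by
          simp only [excess, Finset.mul_sum]
          rw [Finset.sum_congr rfl fun t _ => Finset.sum_comm, Finset.sum_comm]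
          refine Finset.sum_congr rfl fun i _ => ?_
          rw [Finset.sum_congr rfl fun t _ => Finset.sum_comm, Finset.sum_comm]
  rw [heq]
  refine Finset.sum_nonpos fun i _ => Finset.sum_nonpos fun θ _ => ?_
  obtain ⟨h1, h2⟩ := (φ.isPersuasive_iff G hS).1 hφ i θ
  rcases (hS θ.2).1.eq_or_lt with h | h
  · rw [← h]; exact mul_nonpos_of_nonpos_of_nonneg hf h1
  · rw [h2 h, mul_zero]

/-- The distribution of `σ ω` when `ω` is drawn with probability proportional to `w`. -/
def mixture {Ω : Type*} [Fintype Ω] (w : Ω → ℝ) (hw : ∀ ω, 0 ≤ w ω) (hZ : 0 < ∑ ω, w ω)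
    (σ : Ω → V → S) : stdSimplex ℝ (V → S) :=
  ⟨fun s => ∑ ω, if σ ω = s then w ω / ∑ ω, w ω else 0,
    fun s => Finset.sum_nonneg fun ω _ => by
      split_ifs
      · exact div_nonneg (hw ω) hZ.le
      · exact le_rfl,
    by
      rw [Finset.sum_comm]
      simp only [Finset.sum_ite_eq, Finset.mem_univ, if_true]
      rw [← Finset.sum_div, div_self hZ.ne']⟩

theorem sum_mixture_mul {Ω : Type*} [Fintype Ω] (w : Ω → ℝ) (hw : ∀ ω, 0 ≤ w ω)
    (hZ : 0 < ∑ ω, w ω) (σ : Ω → V → S) (F : (V → S) → ℝ) :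
    ∑ s, mixture w hw hZ σ s * F s = (∑ ω, w ω * F (σ ω)) / ∑ ω, w ω := by
  have h : ∀ s, mixture w hw hZ σ s = ∑ ω, if σ ω = s then w ω / ∑ ω, w ω else 0 := fun s => rfl
  simp only [h, Finset.sum_mul]
  rw [Finset.sum_comm, Finset.sum_div]
  refine Finset.sum_congr rfl fun ω _ => ?_
  simp only [ite_mul, zero_mul, Finset.sum_ite_eq, Finset.mem_univ, if_true]
  ring

/-- A scheme that ignores the type profile gives every agent the same excess, and the excess is an
average over the vertices. -/
theorem excess_const (G : WeightedGraph V) (μ : stdSimplex ℝ (V → S))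
    (i : Fin (Fintype.card V)) (θ : S) :
    (Fintype.card V : ℝ) * excess G (fun _ => μ) i θ =
      ∑ s, μ s * ∑ v, if s v = θ then G.contribution (fun v => (s v : ℝ)) v - 1 else 0 := by
  let g : V → ℝ := fun v =>
    ∑ s, μ s * if s v = θ then G.contribution (fun v => (s v : ℝ)) v - 1 else 0
  have h : excess G (fun _ => μ) i θ = ∑ t : TypeProfile V, prior t * g (t i) := by
    refine Finset.sum_congr rfl fun t _ => ?_
    simp only [g, Finset.mul_sum]
    refine Finset.sum_congr rfl fun s _ => ?_
    split_ifs <;> ring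
  rw [h, sum_prior_mul]
  simp only [g, Finset.mul_sum]
  exact Finset.sum_comm

theorem cost_const (μ : stdSimplex ℝ (V → S)) :
    cost (fun _ => μ : SignalingScheme V S) = ∑ s, μ s * l1Norm (fun v => (s v : ℝ)) := by
  unfold cost
  rw [← Finset.sum_mul, sum_prior, one_mul]

end SignalingScheme

open SignalingScheme in
/-- A ternary scheme that ignores the type profile.  A labelling of `V` is drawn with probability
proportional to `w`, and the label `j` is sent as the signal `val j`.  It suffices to balance
the excess of each label. -/
theorem WeightedGraph.hasPersuasiveTernaryScheme_of_labelling {V : Type u} [Fintype V]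
    [DecidableEq V] (G : WeightedGraph V) {Ω : Type*} [Fintype Ω] (w : Ω → ℝ)
    (hw : ∀ ω, 0 ≤ w ω) (hZ : 1 ≤ ∑ ω, w ω) (val : Fin 3 → ℝ) (hval0 : val 0 = 0)
    (hval : ∀ j, j ≠ 0 → 0 < val j ∧ val j ≤ 1) (c : Ω → V → Fin 3)
    (hzero : 0 ≤ ∑ ω, w ω * ∑ v, if c ω v = 0 then
      G.contribution (fun v => val (c ω v)) v - 1 else 0)
    (hpos : ∀ j, j ≠ 0 → ∑ ω, w ω * ∑ v, (if c ω v = j then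
      G.contribution (fun v => val (c ω v)) v - 1 else 0) = 0)
    {B : ℝ} (hB : ∑ ω, w ω * ∑ v, val (c ω v) ≤ B) : G.HasPersuasiveTernaryScheme B := by
  have hval' : ∀ j, 0 ≤ val j ∧ val j ≤ 1 := fun j => by
    by_cases hj : j = 0
    · rw [hj, hval0]; norm_num
    · exact ⟨(hval j hj).1.le, (hval j hj).2⟩
  -- the labels may share a value, so the signal space is padded to three elements
  obtain ⟨S, hS1, hS2, hS3⟩ : ∃ S : Finset ℝ, Finset.univ.image val ⊆ S ∧
      S ⊆ Finset.univ.image val ∪ {0, 1 / 2, 1} ∧ S.card = 3 := by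
    refine Finset.exists_subsuperset_card_eq Finset.subset_union_left ?_ ?_
    · exact Finset.card_image_le.trans (by simp)
    · refine le_trans ?_ (Finset.card_le_card Finset.subset_union_right)
      rw [Finset.card_eq_three.2 ⟨0, 1 / 2, 1, by norm_num, by norm_num, by norm_num, rfl⟩]
  have hSI : (S : Set ℝ) ⊆ Set.Icc 0 1 := by
    intro x hx
    have := hS2 hx
    simp only [Finset.mem_union, Finset.mem_image, Finset.mem_univ, true_and, Finset.mem_insert,
      Finset.mem_singleton] at this
    rcases this with ⟨j, rfl⟩ | rfl | rfl | rfl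
    · exact hval' j
    all_goals norm_num
  have hmem : ∀ j, val j ∈ S := fun j => hS1 (Finset.mem_image_of_mem _ (Finset.mem_univ j))
  have hZ0 : 0 < ∑ ω, w ω := by linarith
  set μ := mixture w hw hZ0 (fun ω v => (⟨val (c ω v), hmem _⟩ : S)) with hμ
  refine ⟨S, fun _ => μ, hSI, hS3, ?_, ?_⟩
  · rw [isPersuasive_iff _ _ hSI]
    intro i θ
    have hn : (0 : ℝ) < Fintype.card V := by exact_mod_cast i.pos
    set E : Fin 3 → ℝ := fun j => ∑ ω, w ω * ∑ v, (if c ω v = j then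
      G.contribution (fun v => val (c ω v)) v - 1 else 0) with hE
    have hex : (Fintype.card V : ℝ) * excess G (fun _ => μ) i θ =
        (∑ j, if val j = θ then E j else 0) / ∑ ω, w ω := by
      rw [excess_const, hμ, sum_mixture_mul]
      congr 1
      have : ∀ j, (if val j = θ then E j else 0) = ∑ ω, w ω * ∑ v, (if c ω v = j then
          (if val j = θ then G.contribution (fun v => val (c ω v)) v - 1 else 0) else 0) := by
        intro j
        split_ifs <;> simp [hE]
      simp only [this]
      rw [Finset.sum_comm]
      refine Finset.sum_congr rfl fun ω _ => ?_
      rw [← Finset.mul_sum, Finset.sum_comm]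
      congr 1
      refine Finset.sum_congr rfl fun v _ => ?_
      simp [Subtype.ext_iff]
    constructor
    · have : 0 ≤ (Fintype.card V : ℝ) * excess G (fun _ => μ) i θ := by
        rw [hex]
        refine div_nonneg (Finset.sum_nonneg fun j _ => ?_) hZ0.le
        split_ifs
        · by_cases hj : j = 0
          · rw [hj]; exact hzero
          · exact (hpos j hj).ge
        · exact le_rfl
      exact nonneg_of_mul_nonneg_right this hn
    · intro hθ
      have : (Fintype.card V : ℝ) * excess G (fun _ => μ) i θ = 0 := by
        rw [hex, Finset.sum_eq_zero, zero_div]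
        intro j _
        split_ifs with h
        · exact hpos j (by rintro rfl; rw [hval0] at h; linarith)
        · rfl
      exact (mul_eq_zero.1 this).resolve_left hn.ne'
  · rw [cost_const, hμ, sum_mixture_mul]
    have h1 : ∑ ω, w ω * l1Norm (fun v => val (c ω v)) = ∑ ω, w ω * ∑ v, val (c ω v) := by
      simp only [l1Norm, abs_of_nonneg (hval' _).1]
    have h0 : 0 ≤ ∑ ω, w ω * ∑ v, val (c ω v) := Finset.sum_nonneg fun ω _ =>
      mul_nonneg (hw ω) (Finset.sum_nonneg fun v _ => (hval' _).1)
    exact (le_of_eq_of_le (congrArg (· / _) h1) (div_le_self h0 hZ)).trans hB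

/-! ### Independent sampling -/

section

variable {V : Type u} [Fintype V] [DecidableEq V]

/-- The probability of the set `X` if every `v : V` is sampled independently with probability
`θ v`. -/
def bernoulliWeight (θ : V → ℝ) (X : Finset V) : ℝ := (∏ v ∈ X, θ v) * ∏ v ∈ Xᶜ, (1 - θ v)

/-- The real-valued indicator function of a finite set. -/
def indic (X : Finset V) (v : V) : ℝ := if v ∈ X then 1 else 0

theorem bernoulliWeight_nonneg {θ : V → ℝ} (h0 : ∀ v, 0 ≤ θ v) (h1 : ∀ v, θ v ≤ 1)
    (X : Finset V) : 0 ≤ bernoulliWeight θ X :=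
  mul_nonneg (Finset.prod_nonneg fun v _ => h0 v)
    (Finset.prod_nonneg fun v _ => sub_nonneg.2 (h1 v))

/-- The probability that a sample contains `A`. -/
theorem sum_bernoulliWeight_superset (θ : V → ℝ) (A : Finset V) :
    ∑ X, bernoulliWeight θ X * (if A ⊆ X then 1 else 0) = ∏ v ∈ A, θ v := by
  have h := Finset.prod_add θ (fun v => if v ∈ A then 0 else 1 - θ v) Finset.univ
  have hl : ∏ v, (θ v + if v ∈ A then 0 else 1 - θ v) = ∏ v ∈ A, θ v := by
    rw [← Finset.prod_subset (Finset.subset_univ A)]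
    · exact Finset.prod_congr rfl fun v hv => by simp [hv]
    · intro v _ hv; simp [hv]
  rw [← hl, h, Finset.powerset_univ]
  refine Finset.sum_congr rfl fun X _ => ?_
  rw [bernoulliWeight, mul_assoc, ← Finset.compl_eq_univ_sdiff]
  congr 1
  split_ifs with hA
  · rw [mul_one]
    refine Finset.prod_congr rfl fun v hv => ?_
    rw [if_neg fun h => Finset.mem_compl.1 hv (hA h)]
  · obtain ⟨v, hv, hvX⟩ := Finset.not_subset.1 hA
    rw [mul_zero, Finset.prod_eq_zero (Finset.mem_compl.2 hvX) (by simp [hv])]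

theorem sum_bernoulliWeight (θ : V → ℝ) : ∑ X, bernoulliWeight θ X = 1 := by
  simpa using sum_bernoulliWeight_superset θ ∅

theorem sum_bernoulliWeight_indic (θ : V → ℝ) (v : V) :
    ∑ X, bernoulliWeight θ X * indic X v = θ v := by
  simpa [indic] using sum_bernoulliWeight_superset θ {v}

theorem sum_bernoulliWeight_indic_mul (θ : V → ℝ) {v v' : V} (h : v ≠ v') :
    ∑ X, bernoulliWeight θ X * (indic X v * indic X v') = θ v * θ v' := by
  have := sum_bernoulliWeight_superset θ {v, v'}
  rw [Finset.prod_pair h] at this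
  rw [← this]
  refine Finset.sum_congr rfl fun X _ => ?_
  by_cases h1 : v ∈ X <;> by_cases h2 : v' ∈ X <;>
    simp [indic, h1, h2, Finset.insert_subset_iff]

end

/-! ### The weights off the diagonal -/

namespace WeightedGraph

section

variable {V : Type u} [DecidableEq V] (G : WeightedGraph V)

/-- The weights with the unit diagonal removed. -/
def offWeight (u v : V) : ℝ := if u = v then 0 else G.weight u v

theorem offWeight_nonneg (u v : V) : 0 ≤ G.offWeight u v := by
  unfold offWeight; split_ifs
  · exact le_rfl
  · exact G.nonneg u v

theorem offWeight_le_one (u v : V) : G.offWeight u v ≤ 1 := by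
  unfold offWeight; split_ifs
  · exact zero_le_one
  · exact G.le_one u v

theorem offWeight_comm (u v : V) : G.offWeight u v = G.offWeight v u := by
  simp only [offWeight, eq_comm, G.symm u v]

end

variable {V : Type u} [Fintype V] [DecidableEq V]

/-- The total contribution that the other vertices make to `v`. -/
def inflow (G : WeightedGraph V) (s : V → ℝ) (v : V) : ℝ := ∑ v', G.offWeight v v' * s v'

/-- The sum of all entries of the coefficient matrix. -/
def totalWeight (G : WeightedGraph V) : ℝ := ∑ u, ∑ v, G.weight u v

variable (G : WeightedGraph V)

theorem contribution_eq (s : V → ℝ) (v : V) : G.contribution s v = s v + G.inflow s v := by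
  have h : ∀ v', G.weight v v' * s v' =
      (if v = v' then s v' else 0) + G.offWeight v v' * s v' := by
    intro v'
    by_cases hv : v = v'
    · subst hv; simp [offWeight, G.self_eq_one]
    · simp [offWeight, hv]
  simp [contribution, inflow, h, Finset.sum_add_distrib]

theorem inflow_mono {f g : V → ℝ} (h : ∀ v, f v ≤ g v) (v : V) : G.inflow f v ≤ G.inflow g v :=
  Finset.sum_le_sum fun v' _ => mul_le_mul_of_nonneg_left (h v') (G.offWeight_nonneg v v')

theorem inflow_nonneg {f : V → ℝ} (h : ∀ v, 0 ≤ f v) (v : V) : 0 ≤ G.inflow f v :=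
  Finset.sum_nonneg fun v' _ => mul_nonneg (G.offWeight_nonneg v v') (h v')

theorem inflow_le_sum {f : V → ℝ} (h : ∀ v, 0 ≤ f v) (v : V) : G.inflow f v ≤ ∑ v', f v' :=
  Finset.sum_le_sum fun v' _ => mul_le_of_le_one_left (h v') (G.offWeight_le_one v v')

theorem inflow_smul (a : ℝ) (f : V → ℝ) (v : V) :
    G.inflow (fun v => a * f v) v = a * G.inflow f v := by
  simp only [inflow, Finset.mul_sum]
  exact Finset.sum_congr rfl fun v' _ => by ring

theorem inflow_one_sub (f : V → ℝ) (v : V) :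
    G.inflow (fun v => 1 - f v) v = G.inflow (fun _ => 1) v - G.inflow f v := by
  simp only [inflow, ← Finset.sum_sub_distrib]
  exact Finset.sum_congr rfl fun v' _ => by ring

theorem sum_mul_inflow_comm (f g : V → ℝ) :
    ∑ v, f v * G.inflow g v = ∑ v, g v * G.inflow f v := by
  simp only [inflow, Finset.mul_sum]
  rw [Finset.sum_comm]
  refine Finset.sum_congr rfl fun u _ => Finset.sum_congr rfl fun v _ => ?_
  rw [G.offWeight_comm]; ring

theorem sum_one_add_inflow_one : ∑ v, (1 + G.inflow (fun _ => 1) v) = G.totalWeight := by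
  refine Finset.sum_congr rfl fun v _ => ?_
  rw [← G.contribution_eq (fun _ => 1)]
  simp [contribution]

theorem card_le_totalWeight : (Fintype.card V : ℝ) ≤ G.totalWeight := by
  rw [← G.sum_one_add_inflow_one, Finset.sum_add_distrib]
  have : 0 ≤ ∑ v, G.inflow (fun _ => 1) v :=
    Finset.sum_nonneg fun v _ => G.inflow_nonneg (fun _ => zero_le_one) v
  simpa using this

/-- Independent sampling commutes with the quadratic expressions that describe the excesses:
these are multi-affine in the indicators, as the diagonal has been removed. -/
theorem sum_bernoulliWeight_mul_quadratic (θ : V → ℝ) (a b c d e : ℝ) :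
    ∑ X, bernoulliWeight θ X *
      ∑ v, (a * indic X v + b) * (c + G.inflow (fun v => d * indic X v + e) v) =
    ∑ v, (a * θ v + b) * (c + G.inflow (fun v => d * θ v + e) v) := by
  simp only [Finset.mul_sum]
  rw [Finset.sum_comm]
  refine Finset.sum_congr rfl fun v _ => ?_
  have h1 : ∀ X : Finset V, bernoulliWeight θ X *
      ((a * indic X v + b) * (c + G.inflow (fun v => d * indic X v + e) v)) =
      (a * c) * (bernoulliWeight θ X * indic X v) + b * c * bernoulliWeight θ X +
      ∑ v', G.offWeight v v' * (a * d * (bernoulliWeight θ X * (indic X v * indic X v')) +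
        a * e * (bernoulliWeight θ X * indic X v) + b * d * (bernoulliWeight θ X * indic X v') +
        b * e * bernoulliWeight θ X) := by
    intro X
    have : ∑ v', G.offWeight v v' * (a * d * (bernoulliWeight θ X * (indic X v * indic X v')) +
        a * e * (bernoulliWeight θ X * indic X v) + b * d * (bernoulliWeight θ X * indic X v') +
        b * e * bernoulliWeight θ X) =
        bernoulliWeight θ X * (a * indic X v + b) *
          G.inflow (fun v => d * indic X v + e) v := by
      rw [inflow, Finset.mul_sum]
      exact Finset.sum_congr rfl fun v' _ => by ring
    rw [this]; ring
  simp only [h1, Finset.sum_add_distrib, ← Finset.mul_sum, sum_bernoulliWeight_indic,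
    sum_bernoulliWeight]
  rw [Finset.sum_comm]
  simp only [← Finset.mul_sum, Finset.sum_add_distrib, sum_bernoulliWeight_indic,
    sum_bernoulliWeight]
  have h2 : ∑ v', G.offWeight v v' * (a * d *
        ∑ X, bernoulliWeight θ X * (indic X v * indic X v') + a * e * θ v + b * d * θ v' +
        b * e * 1) = (a * θ v + b) * G.inflow (fun v => d * θ v + e) v := by
    rw [inflow, Finset.mul_sum]
    refine Finset.sum_congr rfl fun v' _ => ?_
    by_cases hv : v = v'
    · simp [offWeight, hv]
    · rw [sum_bernoulliWeight_indic_mul θ hv]; ring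
  rw [h2]; ring

/-! ### The uniform scheme and the three-phase schemes -/

/-- The scheme with a single signal: everyone is told the effort `n / m`, where `m` is the total
weight. -/
theorem hasPersuasiveTernaryScheme_of_uniform [Nonempty V] {B : ℝ}
    (hB : (Fintype.card V : ℝ) ^ 2 / G.totalWeight ≤ B) : G.HasPersuasiveTernaryScheme B := by
  have hn : (0 : ℝ) < Fintype.card V := by exact_mod_cast Fintype.card_pos
  have hm := G.card_le_totalWeight
  have hm0 : 0 < G.totalWeight := hn.trans_le hm
  set l : ℝ := Fintype.card V / G.totalWeight with hl
  have hl0 : 0 < l := div_pos hn hm0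
  refine G.hasPersuasiveTernaryScheme_of_labelling (Ω := Unit) (fun _ => 1)
    (fun _ => zero_le_one) (by simp) ![0, l, 1] (by simp) ?_ (fun _ _ => 1) (by simp) ?_ ?_
  · intro j hj
    fin_cases j
    · simp at hj
    · exact ⟨hl0, (div_le_one hm0).2 hm⟩
    · simp
  · intro j hj
    fin_cases j
    · simp at hj
    · have h : ∀ v, G.contribution (fun _ => l) v = l * (1 + G.inflow (fun _ => 1) v) := by
        intro v
        rw [G.contribution_eq, mul_add, ← G.inflow_smul]
        simp
      simp only [Finset.univ_unique, Finset.sum_singleton, one_mul]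
      simp [h]
      rw [← Finset.mul_sum, G.sum_one_add_inflow_one, hl]
      field_simp
      ring
    · simp
  · simp
    refine le_of_eq_of_le ?_ hB
    rw [hl]; ring

/-- The three-phase construction. With relative frequencies `1 : η : γ`, one of the following
is done: the signal `h` goes to a sample of the fractional solution `θ`; the signal `h` goes to a
set drawn from `α`; the signal `l` goes to the complement of a sample of `θ`. All other vertices
receive `0`. The hypotheses balance the signals `h`, `l` and `0`. -/
theorem hasPersuasiveTernaryScheme_of_phases {θ : V → ℝ} (h0 : ∀ v, 0 ≤ θ v)
    (h1 : ∀ v, θ v ≤ 1) {l h η γ : ℝ} (hl0 : 0 < l) (hl1 : l ≤ 1) (hh0 : 0 < h) (hh1 : h ≤ 1)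
    (hη : 0 ≤ η) (hγ : 0 ≤ γ) {α : Finset V → ℝ} (hα : ∀ Y, 0 ≤ α Y) (hα1 : ∑ Y, α Y = 1)
    (hhigh : ∑ v, θ v * (h - 1 + h * G.inflow θ v) +
      η * ∑ Y, α Y * ∑ v, indic Y v * (h - 1 + h * G.inflow (indic Y) v) = 0)
    (hlow : ∑ v, (1 - θ v) * (l - 1 + l * G.inflow (fun v => 1 - θ v) v) = 0)
    (hzero : η * Fintype.card V ≤ ∑ v, (1 - θ v) * (-1 + h * G.inflow θ v) +
      γ * ∑ v, θ v * (-1 + l * G.inflow (fun v => 1 - θ v) v))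
    {B : ℝ} (hB : h * ∑ v, θ v + η * Fintype.card V + γ * (l * Fintype.card V) ≤ B) :
    G.HasPersuasiveTernaryScheme B := by
  have hb := bernoulliWeight_nonneg h0 h1
  set lab : Fin 3 × Finset V → V → Fin 3 := fun ω v =>
    if ω.1 = 2 then (if v ∈ ω.2 then 0 else 1) else (if v ∈ ω.2 then 2 else 0) with hlab
  set w : Fin 3 × Finset V → ℝ := fun ω =>
    ![bernoulliWeight θ ω.2, η * α ω.2, γ * bernoulliWeight θ ω.2] ω.1 with hw
  set val : Fin 3 → ℝ := ![0, l, h] with hval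
  have hsum : ∀ F : Fin 3 × Finset V → ℝ, ∑ ω, w ω * F ω =
      ∑ X, bernoulliWeight θ X * F (0, X) + η * ∑ Y, α Y * F (1, Y) +
        γ * ∑ X, bernoulliWeight θ X * F (2, X) := by
    intro F
    rw [Fintype.sum_prod_type, Fin.sum_univ_three]
    simp [hw, Finset.mul_sum, mul_assoc]
  have hv0 : ∀ X, (fun v => val (lab (0, X) v)) = fun v => h * indic X v := by
    intro X; ext v; by_cases hv : v ∈ X <;> simp [hlab, hval, indic, hv]
  have hv1 : ∀ X, (fun v => val (lab (1, X) v)) = fun v => h * indic X v := by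
    intro X; ext v; by_cases hv : v ∈ X <;> simp [hlab, hval, indic, hv]
  have hv2 : ∀ X, (fun v => val (lab (2, X) v)) = fun v => l * (1 - indic X v) := by
    intro X; ext v; by_cases hv : v ∈ X <;> simp [hlab, hval, indic, hv]
  have hquad := G.sum_bernoulliWeight_mul_quadratic θ
  refine G.hasPersuasiveTernaryScheme_of_labelling w ?_ ?_ val (by simp [hval]) ?_ lab ?_ ?_ ?_
  · rintro ⟨i, X⟩
    fin_cases i
    · exact hb X
    · exact mul_nonneg hη (hα X)
    · exact mul_nonneg hγ (hb X)
  · have := hsum fun _ => 1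
    simp only [mul_one, sum_bernoulliWeight, hα1] at this
    rw [this]; linarith
  · intro j hj
    fin_cases j
    · simp at hj
    · exact ⟨hl0, hl1⟩
    · exact ⟨hh0, hh1⟩
  · rw [hsum]
    simp only [hv0, hv1, hv2]
    have e0 : ∀ X, (∑ v, if lab (0, X) v = 0 then
        G.contribution (fun v => h * indic X v) v - 1 else 0) =
        ∑ v, (-1 * indic X v + 1) * (-1 + G.inflow (fun v => h * indic X v + 0) v) := by
      intro X
      refine Finset.sum_congr rfl fun v _ => ?_
      rw [G.contribution_eq]
      by_cases hv : v ∈ X <;> simp [hlab, indic, hv]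
      ring
    have e1 : ∀ Y, -(Fintype.card V : ℝ) ≤ (∑ v, if lab (1, Y) v = 0 then
        G.contribution (fun v => h * indic Y v) v - 1 else 0) := by
      intro Y
      have : ∑ _v : V, (-1 : ℝ) ≤ (∑ v, if lab (1, Y) v = 0 then
          G.contribution (fun v => h * indic Y v) v - 1 else 0) := by
        have hi : ∀ v, 0 ≤ h * indic Y v := fun v =>
          mul_nonneg hh0.le (by unfold indic; split_ifs <;> norm_num)
        refine Finset.sum_le_sum fun v _ => ?_
        rw [G.contribution_eq]
        have := G.inflow_nonneg hi v
        have := hi v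
        split_ifs <;> linarith
      simpa using this
    have e2 : ∀ X, (∑ v, if lab (2, X) v = 0 then
        G.contribution (fun v => l * (1 - indic X v)) v - 1 else 0) =
        ∑ v, (1 * indic X v + 0) * (-1 + G.inflow (fun v => -l * indic X v + l) v) := by
      intro X
      refine Finset.sum_congr rfl fun v _ => ?_
      rw [G.contribution_eq]
      have : (fun v => l * (1 - indic X v)) = fun v => -l * indic X v + l := by ext v; ring
      rw [this]
      by_cases hv : v ∈ X <;> simp [hlab, indic, hv]
      ring
    simp only [e0, e2, hquad]
    have e1' : -(Fintype.card V : ℝ) ≤ ∑ Y, α Y * (∑ v, if lab (1, Y) v = 0 then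
        G.contribution (fun v => h * indic Y v) v - 1 else 0) := by
      calc -(Fintype.card V : ℝ) = ∑ Y, α Y * -(Fintype.card V : ℝ) := by
            rw [← Finset.sum_mul, hα1, one_mul]
        _ ≤ _ := Finset.sum_le_sum fun Y _ => mul_le_mul_of_nonneg_left (e1 Y) (hα Y)
    have e1'' := mul_le_mul_of_nonneg_left e1' hη
    have r0 : ∑ v, (-1 * θ v + 1) * (-1 + G.inflow (fun v => h * θ v + 0) v) =
        ∑ v, (1 - θ v) * (-1 + h * G.inflow θ v) := by
      refine Finset.sum_congr rfl fun v _ => ?_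
      simp only [add_zero, G.inflow_smul]; ring
    have r2 : ∑ v, (1 * θ v + 0) * (-1 + G.inflow (fun v => -l * θ v + l) v) =
        ∑ v, θ v * (-1 + l * G.inflow (fun v => 1 - θ v) v) := by
      refine Finset.sum_congr rfl fun v _ => ?_
      have : (fun v => -l * θ v + l) = fun v => l * (1 - θ v) := by ext v; ring
      rw [this, G.inflow_smul]; ring
    rw [r0, r2]
    linarith
  · intro j hj
    rw [hsum]
    simp only [hv0, hv1, hv2]
    fin_cases j
    · simp at hj
    · have e0 : ∀ X v, lab (0, X) v ≠ 1 := by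
        intro X v; by_cases hv : v ∈ X <;> simp [hlab, hv]
      have e1 : ∀ X v, lab (1, X) v ≠ 1 := by
        intro X v; by_cases hv : v ∈ X <;> simp [hlab, hv]
      have e2 : ∀ X, (∑ v, if lab (2, X) v = 1 then
          G.contribution (fun v => l * (1 - indic X v)) v - 1 else 0) =
          ∑ v, (-1 * indic X v + 1) * (l - 1 + G.inflow (fun v => -l * indic X v + l) v) := by
        intro X
        refine Finset.sum_congr rfl fun v _ => ?_
        rw [G.contribution_eq]
        have : (fun v => l * (1 - indic X v)) = fun v => -l * indic X v + l := by ext v; ring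
        rw [this]
        by_cases hv : v ∈ X <;> simp [hlab, indic, hv]
        ring
      have r2 : ∑ v, (-1 * θ v + 1) * (l - 1 + G.inflow (fun v => -l * θ v + l) v) = 0 := by
        rw [← hlow]
        refine Finset.sum_congr rfl fun v _ => ?_
        have : (fun v => -l * θ v + l) = fun v => l * (1 - θ v) := by ext v; ring
        rw [this, G.inflow_smul]; ring
      simp only [Fin.mk_one, e0, e1, e2, hquad, r2]
      simp
    · have e0 : ∀ X, (∑ v, if lab (0, X) v = 2 then
          G.contribution (fun v => h * indic X v) v - 1 else 0) =
          ∑ v, (1 * indic X v + 0) * (h - 1 + G.inflow (fun v => h * indic X v + 0) v) := by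
        intro X
        refine Finset.sum_congr rfl fun v _ => ?_
        rw [G.contribution_eq]
        by_cases hv : v ∈ X <;> simp [hlab, indic, hv]
        ring
      have e1 : ∀ X, (∑ v, if lab (1, X) v = 2 then
          G.contribution (fun v => h * indic X v) v - 1 else 0) =
          ∑ v, indic X v * (h - 1 + h * G.inflow (indic X) v) := by
        intro X
        refine Finset.sum_congr rfl fun v _ => ?_
        rw [G.contribution_eq, G.inflow_smul]
        by_cases hv : v ∈ X <;> simp [hlab, indic, hv]
        ring
      have e2 : ∀ X v, lab (2, X) v ≠ 2 := by
        intro X v; by_cases hv : v ∈ X <;> simp [hlab, hv]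
      have r0 : ∑ v, (1 * θ v + 0) * (h - 1 + G.inflow (fun v => h * θ v + 0) v) =
          ∑ v, θ v * (h - 1 + h * G.inflow θ v) := by
        refine Finset.sum_congr rfl fun v _ => ?_
        simp only [add_zero, G.inflow_smul]; ring
      simp only [Fin.reduceFinMk, e0, e1, e2, hquad, r0]
      simpa using hhigh
  · rw [hsum]
    refine le_trans ?_ hB
    have c0 : ∑ X, bernoulliWeight θ X * ∑ v, val (lab (0, X) v) = h * ∑ v, θ v := by
      calc _ = ∑ X, bernoulliWeight θ X * ∑ v, h * indic X v :=
            Finset.sum_congr rfl fun X _ => by rw [← hv0]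
        _ = _ := by
            simp only [Finset.mul_sum]
            rw [Finset.sum_comm]
            refine Finset.sum_congr rfl fun v _ => ?_
            rw [← sum_bernoulliWeight_indic θ v, Finset.mul_sum]
            exact Finset.sum_congr rfl fun X _ => by ring
    have hle : ∀ (q : Finset V → ℝ) (i : Fin 3) (M : ℝ), (∀ X, 0 ≤ q X) → ∑ X, q X = 1 →
        (∀ X v, val (lab (i, X) v) ≤ M) →
        ∑ X, q X * ∑ v, val (lab (i, X) v) ≤ M * Fintype.card V := by
      intro q i M hq hq1 hM
      calc _ ≤ ∑ X, q X * ∑ _v : V, M := Finset.sum_le_sum fun X _ =>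
            mul_le_mul_of_nonneg_left (Finset.sum_le_sum fun v _ => hM X v) (hq X)
        _ = _ := by rw [← Finset.sum_mul, hq1]; simp [mul_comm]
    have c1 := hle α 1 1 hα hα1 fun X v => by
      by_cases hv : v ∈ X <;> simp [hlab, hval, hv, hh1]
    have c2 := hle _ 2 l hb (sum_bernoulliWeight θ) fun X v => by
      by_cases hv : v ∈ X <;> simp [hlab, hval, hv, hl0.le]
    rw [c0]
    have := mul_le_mul_of_nonneg_left c1 hη
    have := mul_le_mul_of_nonneg_left c2 hγ
    linarith

/-- Once the signal `h = 1 - ε` is balanced, the effort `l` and the frequency of the last phase can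
be chosen such that the signals `l` and `0` are balanced as well, at cost `O(K)`. -/
theorem hasPersuasiveTernaryScheme_of_high_balance {θ : V → ℝ} (hθ : θ ∈ G.feasibleIR)
    {n O K : ℝ} (hn : (Fintype.card V : ℝ) = n) (hO : ∑ v, θ v = O) (hO1 : 1 ≤ O)
    (hOK : 8 * O ≤ K) (hOn : O + O ^ 2 ≤ n / 4) (hm : G.totalWeight * K ≤ n ^ 2)
    {ε η : ℝ} (hε0 : 0 ≤ ε) (hε1 : ε < 1) (hε : ε * n ≤ K) (hη0 : 0 ≤ η) (hη : η * n ≤ 4 * K)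
    {α : Finset V → ℝ} (hα : ∀ Y, 0 ≤ α Y) (hα1 : ∑ Y, α Y = 1)
    (hhigh : ∑ v, θ v * ((1 - ε) - 1 + (1 - ε) * G.inflow θ v) +
      η * ∑ Y, α Y * ∑ v, indic Y v * ((1 - ε) - 1 + (1 - ε) * G.inflow (indic Y) v) = 0) :
    G.HasPersuasiveTernaryScheme (16 * K) := by
  obtain ⟨hf, h0, h1⟩ := hθ
  have hc0 : ∀ v, 0 ≤ 1 - θ v := fun v => sub_nonneg.2 (h1 v)
  have hn0 : 0 < n := by nlinarith
  have hmn := G.card_le_totalWeight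
  rw [hn] at hmn
  have hm0 : 0 < G.totalWeight := hn0.trans_le hmn
  have hone : ∀ v, 1 - θ v ≤ G.inflow θ v := fun v => by
    have := hf v
    rw [G.contribution_eq] at this
    linarith
  have hcs : ∑ v, (1 - θ v) = n - O := by
    rw [Finset.sum_sub_distrib, hO]; simp [hn]
  -- the effort `l` is chosen so that the signal `l` is balanced
  set R := ∑ v, (1 - θ v) * G.inflow (fun v => 1 - θ v) v with hR
  have hR0 : 0 ≤ R := Finset.sum_nonneg fun v _ => mul_nonneg (hc0 v) (G.inflow_nonneg hc0 v)
  have hnO : 0 < n - O := by nlinarith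
  have hDm : n - O + R ≤ G.totalWeight := by
    rw [← hcs, hR, ← Finset.sum_add_distrib, ← G.sum_one_add_inflow_one]
    refine Finset.sum_le_sum fun v _ => ?_
    have h2 := G.inflow_mono (f := fun v => 1 - θ v) (g := fun _ => 1)
      (fun v => by linarith [h0 v]) v
    have h3 := G.inflow_nonneg hc0 v
    nlinarith [h0 v, h1 v]
  set l := (n - O) / (n - O + R) with hl
  have hD0 : 0 < n - O + R := by linarith
  have hl0 : 0 < l := div_pos hnO hD0
  have hl1 : l ≤ 1 := (div_le_one hD0).2 (by linarith)
  have hln : 3 / 4 * K ≤ l * n := by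
    have h2 : (n - O) / G.totalWeight ≤ l := div_le_div_of_nonneg_left hnO.le hD0 hDm
    have h3 : 3 / 4 * K ≤ (n - O) / G.totalWeight * n := by
      rw [div_mul_eq_mul_div (n - O), le_div_iff₀ hm0]
      nlinarith
    exact h3.trans (mul_le_mul_of_nonneg_right h2 hn0.le)
  have hlow : ∑ v, (1 - θ v) * (l - 1 + l * G.inflow (fun v => 1 - θ v) v) = 0 := by
    have : ∀ v, (1 - θ v) * (l - 1 + l * G.inflow (fun v => 1 - θ v) v) =
        (l - 1) * (1 - θ v) + l * ((1 - θ v) * G.inflow (fun v => 1 - θ v) v) := by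
      intro v; ring
    simp only [this, Finset.sum_add_distrib, ← Finset.mul_sum]
    rw [hcs, ← hR, hl]
    field_simp
    ring
  -- the vertices sampled in the last phase have an excess of order `l * n`
  have hU : l * n / 2 ≤ ∑ v, θ v * (-1 + l * G.inflow (fun v => 1 - θ v) v) := by
    have h2 : ∀ v, θ v * (-1 + l * G.inflow (fun v => 1 - θ v) v) =
        l * (θ v * G.inflow (fun _ => 1) v) - l * (θ v * G.inflow θ v) - θ v := by
      intro v; rw [G.inflow_one_sub]; ring
    simp only [h2, Finset.sum_sub_distrib, ← Finset.mul_sum]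
    rw [hO, G.sum_mul_inflow_comm θ]
    have h3 : n - O ≤ ∑ v, 1 * G.inflow θ v := by
      rw [← hcs]
      exact Finset.sum_le_sum fun v _ => by linarith [hone v]
    have h4 : ∑ v, θ v * G.inflow θ v ≤ O ^ 2 := by
      calc _ ≤ ∑ v, θ v * O := Finset.sum_le_sum fun v _ =>
            mul_le_mul_of_nonneg_left (hO ▸ G.inflow_le_sum h0 v) (h0 v)
        _ = _ := by rw [← Finset.sum_mul, hO]; ring
    have h5 := mul_le_mul_of_nonneg_left h3 hl0.le
    have h6 := mul_le_mul_of_nonneg_left h4 hl0.le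
    have h7 := mul_le_mul_of_nonneg_left hOn hl0.le
    linarith
  have hB0 : -(ε * n + O) ≤ ∑ v, (1 - θ v) * (-1 + (1 - ε) * G.inflow θ v) := by
    have h2 : ∑ v, (-ε - θ v) ≤ ∑ v, (1 - θ v) * (-1 + (1 - ε) * G.inflow θ v) := by
      refine Finset.sum_le_sum fun v _ => ?_
      have h3 : (1 - θ v) * (-1 + (1 - ε) * (1 - θ v)) ≤
          (1 - θ v) * (-1 + (1 - ε) * G.inflow θ v) :=
        mul_le_mul_of_nonneg_left (by nlinarith [hone v]) (hc0 v)
      nlinarith [h0 v, h1 v, mul_nonneg (h0 v) (hc0 v), mul_nonneg hε0 (h0 v),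
        mul_nonneg hε0 (mul_nonneg (h0 v) (hc0 v)), sq_nonneg (θ v)]
    rw [Finset.sum_sub_distrib, hO] at h2
    simp only [Finset.sum_const, Finset.card_univ, nsmul_eq_mul, hn] at h2
    linarith
  have hln0 : 0 < l * n := mul_pos hl0 hn0
  have hnum : 0 ≤ O + ε * n + η * n := by positivity
  refine G.hasPersuasiveTernaryScheme_of_phases h0 h1 hl0 hl1 (sub_pos.2 hε1) (by linarith) hη0
    (γ := 2 * (O + ε * n + η * n) / (l * n)) (by positivity) hα hα1 hhigh hlow ?_ ?_
  · rw [hn]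
    have h2 : 2 * (O + ε * n + η * n) / (l * n) * (l * n / 2) = O + ε * n + η * n := by
      field_simp
    have h3 := mul_le_mul_of_nonneg_left hU
      (show 0 ≤ 2 * (O + ε * n + η * n) / (l * n) by positivity)
    linarith
  · rw [hn, hO, div_mul_cancel₀ _ hln0.ne']
    nlinarith

/-- It suffices that a random set drawn from `α` has a deficit of at least `O ^ 2 * n / (4 * K)` at
the signal `1 - K / n`. Since a sample of the fractional solution has an excess of at most `O ^ 2`,
the set then has to be used with frequency at most `4 * K / n`. -/
theorem hasPersuasiveTernaryScheme_of_deficit {θ : V → ℝ} (hθ : θ ∈ G.feasibleIR)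
    {n O K : ℝ} (hn : (Fintype.card V : ℝ) = n) (hO : ∑ v, θ v = O) (hO1 : 1 ≤ O)
    (hOK : 8 * O ≤ K) (hKn : 16 * K ≤ n) (hOn : O + O ^ 2 ≤ n / 4)
    (hm : G.totalWeight * K ≤ n ^ 2)
    {α : Finset V → ℝ} (hα : ∀ Y, 0 ≤ α Y) (hα1 : ∑ Y, α Y = 1)
    (hdef : ∑ Y, α Y * ∑ v, indic Y v * ((1 - K / n) - 1 + (1 - K / n) * G.inflow (indic Y) v) ≤
      -(O ^ 2 * n / (4 * K))) :
    G.HasPersuasiveTernaryScheme (16 * K) := by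
  have h0 := hθ.2.1
  have hK0 : 0 < K := by linarith
  have hn0 : 0 < n := by linarith
  set q := ∑ v, θ v * G.inflow θ v with hq
  have hq0 : 0 ≤ q := Finset.sum_nonneg fun v _ => mul_nonneg (h0 v) (G.inflow_nonneg h0 v)
  have hqO : q ≤ O ^ 2 := by
    calc _ ≤ ∑ v, θ v * O := Finset.sum_le_sum fun v _ =>
          mul_le_mul_of_nonneg_left (hO ▸ G.inflow_le_sum h0 v) (h0 v)
      _ = _ := by rw [← Finset.sum_mul, hO]; ring
  have hex : ∀ ε, ∑ v, θ v * ((1 - ε) - 1 + (1 - ε) * G.inflow θ v) = (1 - ε) * q - ε * O := by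
    intro ε
    have : ∀ v, θ v * ((1 - ε) - 1 + (1 - ε) * G.inflow θ v) =
        (1 - ε) * (θ v * G.inflow θ v) - ε * θ v := by
      intro v; ring
    simp only [this, Finset.sum_sub_distrib, ← Finset.mul_sum]
    rw [hO]
  have hKn' : K / n ≤ 1 / 16 := by rw [div_le_div_iff₀ hn0 (by norm_num)]; linarith
  have hKn0 : 0 < K / n := div_pos hK0 hn0
  have hKnn : K / n * n = K := div_mul_cancel₀ _ hn0.ne'
  rcases le_or_gt 0 ((1 - K / n) * q - K / n * O) with hpos | hneg
  · set A := ∑ Y, α Y * ∑ v, indic Y v *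
      ((1 - K / n) - 1 + (1 - K / n) * G.inflow (indic Y) v) with hA
    have hD : 0 < O ^ 2 * n / (4 * K) := by positivity
    have hA0 : 0 < -A := by linarith
    have hAne : A ≠ 0 := ne_of_lt (by linarith)
    refine G.hasPersuasiveTernaryScheme_of_high_balance hθ hn hO hO1 hOK hOn hm (ε := K / n)
      (η := ((1 - K / n) * q - K / n * O) / (-A)) hKn0.le (by linarith) hKnn.le
      (div_nonneg hpos hA0.le) ?_ hα hα1 ?_
    · have h2 : ((1 - K / n) * q - K / n * O) ≤ O ^ 2 := by nlinarith
      have h3 : ((1 - K / n) * q - K / n * O) / (-A) ≤ O ^ 2 / (O ^ 2 * n / (4 * K)) :=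
        div_le_div₀ (by positivity) h2 hD (by linarith)
      have h4 : O ^ 2 / (O ^ 2 * n / (4 * K)) * n = 4 * K := by field_simp
      calc _ ≤ _ := mul_le_mul_of_nonneg_right h3 hn0.le
        _ = _ := h4
    · rw [hex, ← hA]
      field_simp
      ring
  · -- the excess changes sign between `h = 1 - K / n` and `h = 1`
    have hOq : 0 < O + q := by linarith
    have hle : q / (O + q) ≤ K / n := by
      rw [div_le_iff₀ hOq]; linarith
    refine G.hasPersuasiveTernaryScheme_of_high_balance hθ hn hO hO1 hOK hOn hm
      (ε := q / (O + q)) (η := 0) (by positivity) (by linarith) ?_ le_rfl (by linarith) hα hα1 ?_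
    · calc _ ≤ _ := mul_le_mul_of_nonneg_right hle hn0.le
        _ = _ := hKnn
    · rw [hex]
      field_simp
      ring

/-! ### Independent sets -/

/-- A large set without edges: a maximal one among the vertices of at most twice the average
degree. Here `M` is the number of nonzero entries of the coefficient matrix. -/
theorem exists_independent {M : ℝ}
    (hM : ∑ v, ((Finset.univ.filter fun u => 0 < G.weight v u).card : ℝ) = M) :
    ∃ I : Finset V, (∀ v ∈ I, ∀ v' ∈ I, G.offWeight v v' = 0) ∧
      (Fintype.card V : ℝ) ^ 2 ≤ 4 * M * I.card := by
  obtain ⟨n, hn⟩ : ∃ n : ℝ, n = Fintype.card V := ⟨_, rfl⟩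
  rw [← hn]
  set N : V → Finset V := fun v => Finset.univ.filter fun u => 0 < G.weight v u with hN
  have hn0 : 0 ≤ n := by rw [hn]; positivity
  have hM0 : 0 ≤ M := by rw [← hM]; exact Finset.sum_nonneg fun v _ => Nat.cast_nonneg _
  set low : Finset V := Finset.univ.filter fun v => n * (N v).card ≤ 2 * M with hlow
  have hlowcard : n ^ 2 ≤ 2 * n * low.card := by
    rcases hM0.eq_or_lt with h | h
    · -- no entry is nonzero, so that there is no vertex
      have hz : low = Finset.univ := by
        refine Finset.filter_true_of_mem fun v hv => ?_
        have : ((N v).card : ℝ) = 0 := by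
          refine (Finset.sum_eq_zero_iff_of_nonneg (fun v _ => Nat.cast_nonneg _)).1
            (hM.trans h.symm) v hv
        rw [this, ← h]; simp
      rw [hz, Finset.card_univ, ← hn]; nlinarith
    · have h1 : (2 * M) * (lowᶜ.card : ℝ) ≤ n * M := by
        calc (2 * M) * (lowᶜ.card : ℝ) = ∑ _v ∈ lowᶜ, 2 * M := by simp [mul_comm]
          _ ≤ ∑ v ∈ lowᶜ, n * (N v).card := Finset.sum_le_sum fun v hv => by
              simp only [hlow, Finset.mem_compl, Finset.mem_filter, Finset.mem_univ, true_and,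
                not_le] at hv
              exact hv.le
          _ ≤ ∑ v, n * (N v).card :=
              Finset.sum_le_sum_of_subset_of_nonneg (Finset.subset_univ _)
                fun v _ _ => mul_nonneg hn0 (Nat.cast_nonneg _)
          _ = n * M := by rw [← Finset.mul_sum, hM]
      have h2 : (low.card : ℝ) + lowᶜ.card = n := by
        rw [hn]; exact_mod_cast Finset.card_add_card_compl low
      have h3 : 2 * (lowᶜ.card : ℝ) ≤ n := by
        have : M * (2 * (lowᶜ.card : ℝ)) ≤ M * n := by linarith
        exact le_of_mul_le_mul_left this h
      nlinarith
  classical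
  let P : Finset V → Prop := fun I => I ⊆ low ∧ ∀ v ∈ I, ∀ v' ∈ I, G.offWeight v v' = 0
  obtain ⟨I, hI⟩ := Finset.exists_maximal (s := Finset.univ.filter P) ⟨∅, by simp [P]⟩
  have hIP : P I := (Finset.mem_filter.1 hI.prop).2
  refine ⟨I, hIP.2, ?_⟩
  have hcover : low ⊆ I.biUnion N := by
    intro x hx
    by_contra hxI
    have hno : ∀ v ∈ I, G.weight v x = 0 := by
      intro v hv
      by_contra hne
      exact hxI (Finset.mem_biUnion.2 ⟨v, hv, Finset.mem_filter.2
        ⟨Finset.mem_univ _, lt_of_le_of_ne (G.nonneg v x) (Ne.symm hne)⟩⟩)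
    have hxI' : x ∉ I := fun h => by
      have := hno x h
      rw [G.self_eq_one] at this
      exact one_ne_zero this
    have hins : P (insert x I) := by
      refine ⟨Finset.insert_subset hx hIP.1, ?_⟩
      intro v hv v' hv'
      rcases Finset.mem_insert.1 hv with rfl | hw <;> rcases Finset.mem_insert.1 hv' with rfl | hw'
      · simp [offWeight]
      · rw [G.offWeight_comm]; simp [offWeight, hno _ hw']
      · simp [offWeight, hno _ hw]
      · exact hIP.2 v hw v' hw'
    exact hxI' (hI.le_of_ge (Finset.mem_filter.2 ⟨Finset.mem_univ _, hins⟩)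
      (Finset.subset_insert x I) (Finset.mem_insert_self x I))
  have h1 : (low.card : ℝ) ≤ ∑ v ∈ I, ((N v).card : ℝ) := by
    exact_mod_cast (Finset.card_le_card hcover).trans Finset.card_biUnion_le
  have h2 : n * low.card ≤ 2 * M * I.card := by
    calc n * low.card ≤ ∑ v ∈ I, n * ((N v).card : ℝ) := by
          rw [← Finset.mul_sum]; exact mul_le_mul_of_nonneg_left h1 hn0
      _ ≤ ∑ _v ∈ I, 2 * M := Finset.sum_le_sum fun v hv => (Finset.mem_filter.1 (hIP.1 hv)).2
      _ = _ := by simp [mul_comm]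
  linarith

end WeightedGraph

/-! ### The benchmark -/

namespace WeightedGraph

variable {V : Type u} [Fintype V] (G : WeightedGraph V)

theorem exists_feasible_sum_eq_optIR : ∃ θ ∈ G.feasibleIR, ∑ v, θ v = G.optIR := by
  obtain ⟨θ, hθ, h⟩ := G.optIR_isLeast.1
  refine ⟨θ, hθ, ?_⟩
  rw [← h, l1Norm]
  exact Finset.sum_congr rfl fun v _ => (abs_of_nonneg (hθ.2.1 v)).symm

theorem one_le_optIR [Nonempty V] : 1 ≤ G.optIR := by
  obtain ⟨θ, hθ, h⟩ := G.exists_feasible_sum_eq_optIR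
  rw [← h]
  exact (hθ.1 (Classical.arbitrary V)).trans
    (Finset.sum_le_sum fun v _ => mul_le_of_le_one_left (hθ.2.1 v) (G.le_one _ v))

theorem optIR_nonneg : 0 ≤ G.optIR := by
  obtain ⟨θ, hθ, h⟩ := G.exists_feasible_sum_eq_optIR
  rw [← h]
  exact Finset.sum_nonneg fun v _ => hθ.2.1 v

end WeightedGraph

/-! ### The upper bounds -/

namespace WeightedGraph

variable {V : Type u} [Fintype V] [DecidableEq V] (G : WeightedGraph V)

/-- The case split shared by both upper bounds: a dense graph, or a large `K`, is served by the
uniform scheme. -/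
theorem hasPersuasiveTernaryScheme_of_le_or [Nonempty V] {K : ℝ} (hK : 0 < K)
    (h : (Fintype.card V : ℝ) < 16 * K ∨ (Fintype.card V : ℝ) ^ 2 < G.totalWeight * K) :
    G.HasPersuasiveTernaryScheme (16 * K) := by
  have hn : (0 : ℝ) < Fintype.card V := by exact_mod_cast Fintype.card_pos
  have hm := G.card_le_totalWeight
  refine G.hasPersuasiveTernaryScheme_of_uniform ?_
  rw [div_le_iff₀ (hn.trans_le hm)]
  rcases h with h | h
  · nlinarith
  · nlinarith

theorem hasPersuasiveTernaryScheme_of_isEmpty [IsEmpty V] {B : ℝ} (hB : 0 ≤ B) :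
    G.HasPersuasiveTernaryScheme B :=
  G.hasPersuasiveTernaryScheme_of_labelling (Ω := Unit) (fun _ => 1) (fun _ => zero_le_one)
    (by simp) ![0, 1, 1] (by simp) (by intro j hj; fin_cases j <;> simp at hj ⊢) (fun _ _ => 1)
    (by simp) (by simp) (by simpa using hB)

/-- The bound for general weights: the high signal is relaxed by a random set of density
`K / (2 * m)`, in which a vertex has on average an inflow of at most half of `K / n`. -/
theorem hasPersuasiveTernaryScheme_general [Nonempty V] {K : ℝ} (hK : 0 < K)
    (hK4 : K ^ 4 = (Fintype.card V : ℝ) ^ 3 * G.optIR ^ 2) :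
    G.HasPersuasiveTernaryScheme (16 * K) := by
  by_cases hc : (Fintype.card V : ℝ) < 16 * K ∨ (Fintype.card V : ℝ) ^ 2 < G.totalWeight * K
  · exact G.hasPersuasiveTernaryScheme_of_le_or hK hc
  rw [not_or, not_lt, not_lt] at hc
  obtain ⟨hKn, hm⟩ := hc
  obtain ⟨θ, hθ, hO⟩ := G.exists_feasible_sum_eq_optIR
  have hO1 := G.one_le_optIR
  have hn1 : (1 : ℝ) ≤ Fintype.card V := by exact_mod_cast Fintype.card_pos
  have hmn := G.card_le_totalWeight
  have hone := G.sum_one_add_inflow_one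
  set O := G.optIR
  set m := G.totalWeight
  generalize hn : (Fintype.card V : ℝ) = n at *
  have hm0 : 0 < m := by linarith
  have hn3 : 0 < n ^ 3 := by positivity
  have hOn : 65536 * O ^ 2 ≤ n := by
    have h1 : (16 * K) ^ 4 ≤ n ^ 4 := pow_le_pow_left₀ (by positivity) hKn 4
    have h2 : n ^ 3 * (65536 * O ^ 2) ≤ n ^ 3 * n := by
      calc n ^ 3 * (65536 * O ^ 2) = (16 * K) ^ 4 := by rw [mul_pow, hK4]; ring
        _ ≤ _ := h1
        _ = _ := by ring
    exact le_of_mul_le_mul_left h2 hn3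
  have hOO : O ≤ O ^ 2 := by nlinarith
  have hOK : 8 * O ≤ K := by
    refine le_of_pow_le_pow_left₀ (n := 4) (by norm_num) hK.le ?_
    rw [hK4]
    have h1 : n ≤ n ^ 3 := le_self_pow₀ hn1 (by norm_num)
    calc (8 * O) ^ 4 = (4096 * O ^ 2) * O ^ 2 := by ring
      _ ≤ n ^ 3 * O ^ 2 := mul_le_mul_of_nonneg_right (by linarith [sq_nonneg O]) (sq_nonneg O)
  set p := K / (2 * m) with hp
  have hp0 : 0 ≤ p := by positivity
  have hp1 : p ≤ 1 := by rw [hp, div_le_one (by positivity)]; linarith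
  refine G.hasPersuasiveTernaryScheme_of_deficit hθ hn hO hO1 hOK hKn (by linarith) hm
    (α := bernoulliWeight fun _ => p)
    (bernoulliWeight_nonneg (fun _ => hp0) (fun _ => hp1)) (sum_bernoulliWeight _) ?_
  set ε := K / n with hε
  have hε0 : 0 < ε := by positivity
  have hε1 : ε ≤ 1 := by rw [hε, div_le_one (by linarith)]; linarith
  have h1 : ∑ Y, bernoulliWeight (fun _ => p) Y *
      ∑ v, indic Y v * ((1 - ε) - 1 + (1 - ε) * G.inflow (indic Y) v) =
      -(p * ε * n) + (1 - ε) * p ^ 2 * (m - n) := by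
    have h2 := G.sum_bernoulliWeight_mul_quadratic (fun _ => p) 1 0 ((1 - ε) - 1) (1 - ε) 0
    simp only [one_mul, add_zero, G.inflow_smul] at h2
    have h4 : G.inflow (fun _ => p) = fun v => p * G.inflow (fun _ => 1) v := by
      ext v; rw [← G.inflow_smul]; simp
    rw [h2, h4]
    have h5 : ∑ v, G.inflow (fun _ => 1) v = m - n := by
      rw [Finset.sum_add_distrib] at hone
      simp only [Finset.sum_const, Finset.card_univ, nsmul_eq_mul, mul_one, hn] at hone
      linarith
    simp only [mul_add, Finset.sum_add_distrib, ← Finset.mul_sum, h5, Finset.sum_const,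
      Finset.card_univ, nsmul_eq_mul, hn]
    ring
  rw [h1]
  have hεn : ε * n = K := div_mul_cancel₀ _ (by linarith)
  have hpm : p * m = K / 2 := by rw [hp]; field_simp
  have h6 : -(p * ε * n) + (1 - ε) * p ^ 2 * (m - n) ≤ -(p * K / 2) := by
    have h7 : (1 - ε) * p ^ 2 * (m - n) ≤ p ^ 2 * m := by
      have := mul_nonneg hε0.le (mul_nonneg (sq_nonneg p) (sub_nonneg.2 hmn))
      have := mul_nonneg (sq_nonneg p) (by linarith : 0 ≤ n)
      nlinarith
    have h8 : p ^ 2 * m = p * K / 2 := by rw [sq, mul_assoc, hpm]; ring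
    have h9 : p * ε * n = p * K := by rw [mul_assoc, hεn]
    linarith
  refine h6.trans (neg_le_neg ?_)
  have h10 : p * K / 2 = K ^ 2 / (4 * m) := by rw [hp]; field_simp; norm_num
  rw [h10, div_le_div_iff₀ (by positivity) (by positivity)]
  have h11 : n ^ 2 * (O ^ 2 * n) = K ^ 4 := by rw [hK4]; ring
  have h12 : m * K * (O ^ 2 * n) ≤ n ^ 2 * (O ^ 2 * n) :=
    mul_le_mul_of_nonneg_right hm (by positivity)
  have h13 : K * (O ^ 2 * n * m) ≤ K * K ^ 3 := by
    calc _ = m * K * (O ^ 2 * n) := by ring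
      _ ≤ K ^ 4 := h12.trans h11.le
      _ = _ := by ring
  have h14 := le_of_mul_le_mul_left h13 hK
  nlinarith

/-- The bound for edge weights at least `δ`: the high signal is relaxed by an independent set. -/
theorem hasPersuasiveTernaryScheme_of_edgeWeightsAtLeast [Nonempty V] {K δ : ℝ} (hK : 0 < K)
    (hδ0 : 0 < δ) (hδ1 : δ ≤ 1) (hδ : G.EdgeWeightsAtLeast δ)
    (hK3 : K ^ 3 * δ = ((Fintype.card V : ℝ) * G.optIR) ^ 2) :
    G.HasPersuasiveTernaryScheme (16 * K) := by
  by_cases hc : (Fintype.card V : ℝ) < 16 * K ∨ (Fintype.card V : ℝ) ^ 2 < G.totalWeight * K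
  · exact G.hasPersuasiveTernaryScheme_of_le_or hK hc
  rw [not_or, not_lt, not_lt] at hc
  obtain ⟨hKn, hm⟩ := hc
  obtain ⟨θ, hθ, hO⟩ := G.exists_feasible_sum_eq_optIR
  obtain ⟨I, hI, hIcard⟩ := G.exists_independent rfl
  set M := ∑ v, ((Finset.univ.filter fun u => 0 < G.weight v u).card : ℝ) with hM
  have hMm : δ * M ≤ G.totalWeight := by
    rw [hM, Finset.mul_sum]
    refine Finset.sum_le_sum fun v _ => ?_
    rw [Finset.card_filter, Nat.cast_sum, Finset.mul_sum]
    refine Finset.sum_le_sum fun u _ => ?_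
    split_ifs with h
    · by_cases hvu : v = u
      · subst hvu; rw [G.self_eq_one]; simpa using hδ1
      · simpa using hδ v u ⟨hvu, h⟩
    · simpa using G.nonneg v u
  have hO1 := G.one_le_optIR
  have hn1 : (1 : ℝ) ≤ Fintype.card V := by exact_mod_cast Fintype.card_pos
  set O := G.optIR
  set m := G.totalWeight
  generalize hn : (Fintype.card V : ℝ) = n at *
  have hn0 : 0 < n := by linarith
  have hK3' : (n * O) ^ 2 ≤ K ^ 3 := by
    rw [← hK3]; exact mul_le_of_le_one_right (by positivity) hδ1
  have hOn : 4096 * O ^ 2 ≤ n := by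
    have h1 : (16 * K) ^ 3 ≤ n ^ 3 := pow_le_pow_left₀ (by positivity) hKn 3
    have h2 : n ^ 2 * (4096 * O ^ 2) ≤ n ^ 2 * n := by
      calc n ^ 2 * (4096 * O ^ 2) = 4096 * (n * O) ^ 2 := by ring
        _ ≤ 4096 * K ^ 3 := by linarith
        _ = (16 * K) ^ 3 := by ring
        _ ≤ _ := h1
        _ = _ := by ring
    exact le_of_mul_le_mul_left h2 (by positivity)
  have hOO : O ≤ O ^ 2 := by nlinarith
  have hOK : 8 * O ≤ K := by
    refine le_of_pow_le_pow_left₀ (n := 3) (by norm_num) hK.le (le_trans ?_ hK3')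
    have h1 : n ≤ n ^ 2 := le_self_pow₀ hn1 (by norm_num)
    calc (8 * O) ^ 3 = (512 * O) * O ^ 2 := by ring
      _ ≤ n ^ 2 * O ^ 2 := mul_le_mul_of_nonneg_right (by linarith) (sq_nonneg O)
      _ = _ := by ring
  refine G.hasPersuasiveTernaryScheme_of_deficit hθ hn hO hO1 hOK hKn (by linarith) hm
    (α := fun Y => if Y = I then 1 else 0) (fun Y => by positivity) (by simp) ?_
  have hinf : ∀ v, indic I v * ((1 - K / n) - 1 + (1 - K / n) * G.inflow (indic I) v) =
      -(K / n) * indic I v := by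
    intro v
    by_cases hv : v ∈ I
    · have : G.inflow (indic I) v = 0 := Finset.sum_eq_zero fun v' _ => by
        by_cases hv' : v' ∈ I
        · rw [hI v hv v' hv', zero_mul]
        · simp [indic, hv']
      rw [this]; ring
    · simp [indic, hv]
  simp only [ite_mul, one_mul, zero_mul, Finset.sum_ite_eq', Finset.mem_univ, if_true, hinf]
  rw [← Finset.mul_sum]
  have hcard : ∑ v, indic I v = I.card := by simp [indic]
  rw [hcard, neg_mul]
  refine neg_le_neg ?_
  have hy : (0 : ℝ) ≤ I.card := by positivity
  generalize (I.card : ℝ) = y at *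
  rw [div_mul_eq_mul_div, div_le_div_iff₀ (by positivity) hn0]
  -- it remains to combine `δ M ≤ m`, `m K ≤ n ^ 2` and `n ^ 2 ≤ 4 M y`
  have h1 : δ * K * n ^ 2 ≤ n ^ 2 * (4 * y) := by
    calc δ * K * n ^ 2 ≤ δ * K * (4 * M * y) := mul_le_mul_of_nonneg_left hIcard (by positivity)
      _ = (δ * M) * (K * (4 * y)) := by ring
      _ ≤ m * (K * (4 * y)) := mul_le_mul_of_nonneg_right hMm (by positivity)
      _ = m * K * (4 * y) := by ring
      _ ≤ _ := mul_le_mul_of_nonneg_right hm (by positivity)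
  have h2 : δ * K ≤ 4 * y := by
    have : n ^ 2 * (δ * K) ≤ n ^ 2 * (4 * y) := by linarith
    exact le_of_mul_le_mul_left this (by positivity)
  calc O ^ 2 * n * n = K ^ 3 * δ := by rw [hK3]; ring
    _ = K ^ 2 * (δ * K) := by ring
    _ ≤ K ^ 2 * (4 * y) := mul_le_mul_of_nonneg_left h2 (by positivity)
    _ = _ := by ring

end WeightedGraph

/-! ### Two centers and disjoint cliques -/

namespace CenterCliqueVertex

/-- The total effort of the two centers. -/
def centerSum {k : ℕ} (s : CenterCliqueVertex k → ℝ) : ℝ := ∑ a, s (.inl a)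

/-- The total effort of the leaves in the group `j`. -/
def groupSum {k : ℕ} (s : CenterCliqueVertex k → ℝ) (j : Fin (k ^ 2)) : ℝ := ∑ i, s (.inr (j, i))

theorem sum_eq {k : ℕ} (s : CenterCliqueVertex k → ℝ) :
    ∑ v, s v = s (.inl 0) + s (.inl 1) + ∑ j, ∑ i, s (.inr (j, i)) := by
  rw [Fintype.sum_sum_type, Fintype.sum_prod_type, Fin.sum_univ_two]

theorem contribution_center {k : ℕ} (s : CenterCliqueVertex k → ℝ) (a : Fin 2) :
    (centerCliqueGraph k).contribution s (.inl a) =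
      (s (.inl a) + centerSum s + ∑ j, groupSum s j) / 2 := by
  have h : ∀ v, (centerCliqueGraph k).weight (.inl a) v * s v =
      (1 / 2) * s v + if v = .inl a then (1 / 2) * s (.inl a) else 0 := by
    intro v
    by_cases hv : v = .inl a
    · subst hv; simp [centerCliqueGraph]; ring
    · simp [centerCliqueGraph, hv, Ne.symm hv, Linked]
  unfold WeightedGraph.contribution
  simp only [h, Finset.sum_add_distrib, ← Finset.mul_sum, Finset.sum_ite_eq', Finset.mem_univ,
    if_true, sum_eq]
  simp only [centerSum, groupSum, Fin.sum_univ_two]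
  ring

theorem contribution_leaf {k : ℕ} (s : CenterCliqueVertex k → ℝ) (j : Fin (k ^ 2)) (i : Fin k) :
    (centerCliqueGraph k).contribution s (.inr (j, i)) =
      (s (.inr (j, i)) + centerSum s + groupSum s j) / 2 := by
  have h : ∀ v, (centerCliqueGraph k).weight (.inr (j, i)) v * s v =
      (match v with
        | .inl _ => (1 / 2) * s v
        | .inr y => if y.1 = j then (1 / 2) * s v else 0) +
      if v = .inr (j, i) then (1 / 2) * s (.inr (j, i)) else 0 := by
    rintro (a | ⟨j', i'⟩)
    · simp [centerCliqueGraph, Linked]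
    · by_cases hj : j' = j
      · subst hj
        by_cases hi : i' = i
        · subst hi; simp [centerCliqueGraph]; ring
        · simp [centerCliqueGraph, hi, Ne.symm hi, Linked]
      · simp [centerCliqueGraph, hj, Ne.symm hj, Linked]
  unfold WeightedGraph.contribution
  simp only [h, Finset.sum_add_distrib, Finset.sum_ite_eq', Finset.mem_univ, if_true, sum_eq]
  rw [Finset.sum_eq_single j (fun j' _ hj' => by simp [hj']) (by simp)]
  simp only [if_true, ← Finset.mul_sum]
  simp only [centerSum, groupSum, Fin.sum_univ_two]
  ring

theorem optIR_eq_two {k : ℕ} (hk : 2 ≤ k) : (centerCliqueGraph k).optIR = 2 := by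
  refine (centerCliqueGraph k).optIR_isLeast.unique ⟨⟨fun v => Sum.elim 1 0 v, ⟨?_, ?_, ?_⟩, ?_⟩, ?_⟩
  · rintro (a | ⟨j, i⟩)
    · rw [contribution_center]; simp [centerSum, groupSum]; norm_num
    · rw [contribution_leaf]; simp [centerSum, groupSum]
  · rintro (a | x) <;> simp
  · rintro (a | x) <;> simp
  · rw [l1Norm, sum_eq]; simp; norm_num
  · rintro _ ⟨θ, ⟨h1, h2, -⟩, rfl⟩
    have hl : l1Norm θ = centerSum θ + ∑ j, groupSum θ j := by
      simp only [l1Norm, abs_of_nonneg (h2 _), sum_eq, centerSum, groupSum, Fin.sum_univ_two]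
    rw [hl]
    -- summing feasibility over all leaves
    have hsum : ∑ _j : Fin (k ^ 2), ∑ _i : Fin k, (2 : ℝ) ≤
        ∑ j, ∑ i, (θ (.inr (j, i)) + centerSum θ + groupSum θ j) := by
      refine Finset.sum_le_sum fun j _ => Finset.sum_le_sum fun i _ => ?_
      have := h1 (.inr (j, i))
      rw [contribution_leaf] at this
      linarith
    simp only [Finset.sum_add_distrib, Finset.sum_const, Finset.card_univ, Fintype.card_fin,
      nsmul_eq_mul, ← Finset.mul_sum] at hsum
    have hg : ∑ j, ∑ i, θ (.inr (j, i)) = ∑ j, groupSum θ j := rfl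
    rw [hg] at hsum
    have hL : 0 ≤ ∑ j, groupSum θ j :=
      Finset.sum_nonneg fun j _ => Finset.sum_nonneg fun i _ => h2 _
    have hk' : (2 : ℝ) ≤ k := by exact_mod_cast hk
    push_cast at hsum
    have h3 : (k : ℝ) + 1 ≤ k ^ 3 := by nlinarith [sq_nonneg ((k : ℝ) - 2)]
    have h4 : 2 * (k : ℝ) ^ 3 ≤ k ^ 3 * (centerSum θ + ∑ j, groupSum θ j) := by
      nlinarith [mul_le_mul_of_nonneg_right h3 hL]
    have h5 : (0 : ℝ) < k ^ 3 := by positivity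
    nlinarith

/-- The test function of the lower bound. The affine part measures the total slack; the jump
isolates the signals close to `1`, which a center has to receive but which leave a leaf only a
deficit of at most `1 / (4 * k)`. -/
def testFun (k : ℕ) (x : ℝ) : ℝ :=
  k * x - 2 + if 1 - 1 / (4 * k) ≤ x then (k : ℝ) ^ 2 / 8 else 0

/-- A leaf at a signal `x` close to `1` has a deficit of at most `1 - x`, which the quadratic term
absorbs. -/
theorem leaf_jump_bound {k x C g : ℝ} (hk : 2 ≤ k) (hC : 0 ≤ C) (hg : x ≤ g) :
    0 ≤ k / 2 * x ^ 2 +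
      (if 1 - 1 / (4 * k) ≤ x then k ^ 2 / 8 else 0) * ((x + C + g) / 2 - 1) := by
  split_ifs with h
  · have h1 : k * (1 / (4 * k)) = 1 / 4 := by field_simp
    have h2 : 1 / (4 * k) ≤ 1 / 8 := by
      rw [div_le_div_iff₀ (by positivity) (by norm_num)]; linarith
    have h3 : k ^ 2 / 8 * (x - 1) ≤ k ^ 2 / 8 * ((x + C + g) / 2 - 1) :=
      mul_le_mul_of_nonneg_left (by linarith) (by positivity)
    have h4 : k ^ 2 / 8 * (-(1 / (4 * k))) ≤ k ^ 2 / 8 * (x - 1) :=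
      mul_le_mul_of_nonneg_left (by linarith) (by positivity)
    have h5 : k ^ 2 / 8 * (-(1 / (4 * k))) = -(k / 32) := by field_simp; norm_num
    have h6 : (7 / 8 : ℝ) ^ 2 ≤ x ^ 2 := by gcongr; linarith
    nlinarith
  · nlinarith [mul_nonneg (show (0:ℝ) ≤ k by linarith) (sq_nonneg x)]

/-- The affine part of the test function. The combination `k * s v - 2` is chosen such that
everything completes to squares up to `C * (2 - C)`, where `C` is the effort of the centers; the
summand `3 * ∑ L_j` is the slack coming from the own effort of the leaves and from the inflow of
the centers. -/
theorem affine_bound {k : ℕ} (hk : 2 ≤ k) (s : CenterCliqueVertex k → ℝ)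
    (hs0 : ∀ v, 0 ≤ s v) (hs1 : ∀ v, s v ≤ 1) :
    (k : ℝ) / 2 * ∑ j, ∑ i, s (.inr (j, i)) ^ 2 +
      (k : ℝ) / 2 * ∑ j, (groupSum s j + centerSum s - 2) ^ 2 +
      3 / 8 * (k : ℝ) ^ 3 * (centerSum s * (2 - centerSum s)) ≤
    3 * ∑ j, groupSum s j +
      ∑ v, (k * s v - 2) * ((centerCliqueGraph k).contribution s v - 1) := by
  have hk' : (2 : ℝ) ≤ k := by exact_mod_cast hk
  rw [sum_eq]
  simp only [contribution_center, contribution_leaf]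
  set C := centerSum s with hC
  set L := ∑ j, groupSum s j with hL
  have hCe : C = s (.inl 0) + s (.inl 1) := by simp [hC, centerSum]
  have hleaf : ∀ j, ∑ i, (k * s (.inr (j, i)) - 2) *
      ((s (.inr (j, i)) + C + groupSum s j) / 2 - 1) =
      (k : ℝ) / 2 * ∑ i, s (.inr (j, i)) ^ 2 +
        (k / 2 * ((groupSum s j - 2) * (groupSum s j + C - 2)) - groupSum s j) := by
    intro j
    have : ∀ i, (k * s (.inr (j, i)) - 2) * ((s (.inr (j, i)) + C + groupSum s j) / 2 - 1) =
        (k : ℝ) / 2 * s (.inr (j, i)) ^ 2 +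
        (k * (C + groupSum s j - 2) / 2 - 1) * s (.inr (j, i)) - (C + groupSum s j - 2) := by
      intro i; ring
    simp only [this, Finset.sum_add_distrib, Finset.sum_sub_distrib, ← Finset.mul_sum,
      Finset.sum_const, Finset.card_univ, Fintype.card_fin, nsmul_eq_mul]
    change _ + _ * groupSum s j - _ = _
    ring
  have hsq : ∑ j, (k / 2 * ((groupSum s j - 2) * (groupSum s j + C - 2)) - groupSum s j) =
      k / 2 * ∑ j, (groupSum s j + C - 2) ^ 2 + (k : ℝ) ^ 3 / 2 * (C * (2 - C)) -
        k / 2 * C * L - L := by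
    have : ∀ j, (k / 2 * ((groupSum s j - 2) * (groupSum s j + C - 2)) - groupSum s j) =
        k / 2 * (groupSum s j + C - 2) ^ 2 + k / 2 * (C * (2 - C)) -
          (k / 2 * C + 1) * groupSum s j := by
      intro j; ring
    simp only [this, Finset.sum_add_distrib, Finset.sum_sub_distrib, ← Finset.mul_sum,
      Finset.sum_const, Finset.card_univ, Fintype.card_fin, nsmul_eq_mul]
    push_cast
    ring
  simp only [hleaf]
  rw [Finset.sum_add_distrib, ← Finset.mul_sum, hsq]
  have hC0 : 0 ≤ C := by rw [hCe]; linarith [hs0 (.inl 0), hs0 (.inl 1)]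
  have hC2 : C ≤ 2 := by rw [hCe]; linarith [hs1 (.inl 0), hs1 (.inl 1)]
  have hCC : 0 ≤ C * (2 - C) := mul_nonneg hC0 (by linarith)
  have hkk : (k : ℝ) / 2 ≤ k ^ 3 / 8 := by nlinarith [sq_nonneg ((k : ℝ) - 2)]
  have h1 := mul_le_mul_of_nonneg_right hkk hCC
  have h2 : 0 ≤ (k : ℝ) * (s (.inl 0) - s (.inl 1)) ^ 2 := by positivity
  have h3 : 0 ≤ ((k : ℝ) - 2) * C ^ 2 := mul_nonneg (by linarith) (sq_nonneg C)
  have h4 : 0 ≤ (2 - C) * (4 - C) := mul_nonneg (by linarith) (by linarith)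
  have h5 : (k * s (.inl 0) - 2) * ((s (.inl 0) + C + L) / 2 - 1) +
      (k * s (.inl 1) - 2) * ((s (.inl 1) + C + L) / 2 - 1) =
      k / 4 * (s (.inl 0) - s (.inl 1)) ^ 2 + k / 4 * C ^ 2 + (k * C - 4) * (C + L - 2) / 2 - C := by
    rw [hCe]; ring
  rw [h5]
  nlinarith

/-- The two centers, with efforts `a` and `b`. If both receive a signal close to `1`, they have an
excess of order `1`; otherwise `2 - (a + b)` is of order `1 / k` at least. -/
theorem center_jump_bound {k a b L : ℝ} (hk : 2 ≤ k) (ha0 : 0 ≤ a) (hb0 : 0 ≤ b) (ha1 : a ≤ 1)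
    (hb1 : b ≤ 1) (hL : 0 ≤ L) (hab : 1 / 2 ≤ a + b) :
    k ^ 2 / 16 ≤ 3 / 8 * k ^ 3 * ((a + b) * (2 - (a + b))) +
      ((if 1 - 1 / (4 * k) ≤ a then k ^ 2 / 8 else 0) * ((a + (a + b) + L) / 2 - 1) +
        (if 1 - 1 / (4 * k) ≤ b then k ^ 2 / 8 else 0) * ((b + (a + b) + L) / 2 - 1)) := by
  have hinv : 1 / (4 * k) ≤ 1 / 8 := by
    rw [div_le_div_iff₀ (by positivity) (by norm_num)]; linarith
  have hinv0 : 0 < 1 / (4 * k) := by positivity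
  have hk2 : 0 < k ^ 2 := by positivity
  have hk3 : 0 < k ^ 3 := by positivity
  have h1 : k * (1 / (4 * k)) = 1 / 4 := by field_simp
  set e := 1 / (4 * k) with he
  have hlow : ∀ x y : ℝ, 0 ≤ y → 1 - e ≤ x →
      -(k ^ 2 / 64) ≤ k ^ 2 / 8 * ((x + (x + y) + L) / 2 - 1) := by
    intro x y hy hx
    nlinarith
  have hgap : ∀ C : ℝ, 7 / 8 ≤ C → C ≤ 2 - e → 21 / 256 * k ^ 2 ≤ 3 / 8 * k ^ 3 * (C * (2 - C)) := by
    intro C h7 h8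
    have h9 : 7 / 8 * e ≤ C * (2 - C) := mul_le_mul h7 (by linarith) hinv0.le (by linarith)
    calc 21 / 256 * k ^ 2 = 3 / 8 * k ^ 2 * (7 / 8 * (k * e)) := by rw [h1]; ring
      _ = 3 / 8 * k ^ 3 * (7 / 8 * e) := by ring
      _ ≤ _ := mul_le_mul_of_nonneg_left h9 (by positivity)
  split_ifs with h2 h3 h3
  · have : 0 ≤ 3 / 8 * k ^ 3 * ((a + b) * (2 - (a + b))) :=
      mul_nonneg (by positivity) (mul_nonneg (by linarith) (by linarith))
    nlinarith
  · have := hlow a b hb0 h2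
    have := hgap (a + b) (by linarith) (by linarith)
    nlinarith
  · have := hlow b a ha0 h3
    rw [add_comm b a] at this
    have := hgap (a + b) (by linarith) (by linarith)
    nlinarith
  · have h9 : 1 / 2 * (2 * e) ≤ (a + b) * (2 - (a + b)) :=
      mul_le_mul hab (by linarith) (by linarith) (by linarith)
    have h10 : 3 / 8 * k ^ 3 * (1 / 2 * (2 * e)) = 3 / 32 * k ^ 2 := by
      calc _ = 3 / 8 * k ^ 2 * (k * e) := by ring
        _ = _ := by rw [h1]; ring
    have h11 := mul_le_mul_of_nonneg_left h9 (show 0 ≤ 3 / 8 * k ^ 3 by positivity)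
    nlinarith

/-- For every vector of efforts, the total effort is of order `k ^ 2` up to the sum of the excesses
weighted by the test function. -/
theorem pointwise_bound {k : ℕ} (hk : 2 ≤ k) (s : CenterCliqueVertex k → ℝ)
    (hs0 : ∀ v, 0 ≤ s v) (hs1 : ∀ v, s v ≤ 1) :
    (k : ℝ) ^ 2 / 16 ≤ 4 * l1Norm s +
      ∑ v, testFun k (s v) * ((centerCliqueGraph k).contribution s v - 1) := by
  have hk' : (2 : ℝ) ≤ k := by exact_mod_cast hk
  have haff := affine_bound hk s hs0 hs1
  set C := centerSum s with hC
  have hCe : C = s (.inl 0) + s (.inl 1) := by simp [hC, centerSum]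
  have hC0 : 0 ≤ C := by rw [hCe]; linarith [hs0 (.inl 0), hs0 (.inl 1)]
  have hC2 : C ≤ 2 := by rw [hCe]; linarith [hs1 (.inl 0), hs1 (.inl 1)]
  have hg0 : ∀ j, 0 ≤ groupSum s j := fun j => Finset.sum_nonneg fun i _ => hs0 _
  have hL : 0 ≤ ∑ j, groupSum s j := Finset.sum_nonneg fun j _ => hg0 j
  have hl1 : l1Norm s = C + ∑ j, groupSum s j := by
    simp only [l1Norm, abs_of_nonneg (hs0 _), sum_eq, hCe, groupSum]
  have hsplit : ∑ v, testFun k (s v) * ((centerCliqueGraph k).contribution s v - 1) =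
      ∑ v, (k * s v - 2) * ((centerCliqueGraph k).contribution s v - 1) +
      ∑ v, (if 1 - 1 / (4 * (k : ℝ)) ≤ s v then (k : ℝ) ^ 2 / 8 else 0) *
        ((centerCliqueGraph k).contribution s v - 1) := by
    rw [← Finset.sum_add_distrib]
    exact Finset.sum_congr rfl fun v _ => by rw [testFun]; ring
  rw [hsplit, sum_eq (fun v => (if 1 - 1 / (4 * (k : ℝ)) ≤ s v then (k : ℝ) ^ 2 / 8 else 0) *
    ((centerCliqueGraph k).contribution s v - 1))]
  simp only [contribution_center s, contribution_leaf s]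
  rw [← hC]
  have hleaf : 0 ≤ (k : ℝ) / 2 * ∑ j, ∑ i, s (.inr (j, i)) ^ 2 +
      ∑ j, ∑ i, (if 1 - 1 / (4 * (k : ℝ)) ≤ s (.inr (j, i)) then (k : ℝ) ^ 2 / 8 else 0) *
        ((s (.inr (j, i)) + C + groupSum s j) / 2 - 1) := by
    simp only [Finset.mul_sum, ← Finset.sum_add_distrib]
    exact Finset.sum_nonneg fun j _ => Finset.sum_nonneg fun i _ =>
      leaf_jump_bound hk' hC0
        (Finset.single_le_sum (f := fun i => s (.inr (j, i))) (fun i _ => hs0 _)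
          (Finset.mem_univ i))
  have hsq : 0 ≤ ∑ j, (groupSum s j + C - 2) ^ 2 := Finset.sum_nonneg fun j _ => sq_nonneg _
  have hksq : 0 ≤ (k : ℝ) / 2 * ∑ j, (groupSum s j + C - 2) ^ 2 := mul_nonneg (by linarith) hsq
  rcases le_or_gt (1 / 2) C with hhalf | hhalf
  · have := center_jump_bound hk' (hs0 (.inl 0)) (hs0 (.inl 1)) (hs1 (.inl 0)) (hs1 (.inl 1)) hL
      (by rw [← hCe]; exact hhalf)
    rw [← hCe] at this
    linarith
  · -- no center receives a signal close to `1`, and every group lacks quality or costs `Ω(1)`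
    have hinv : 1 / (4 * (k : ℝ)) ≤ 1 / 8 := by
      rw [div_le_div_iff₀ (by positivity) (by norm_num)]; linarith
    rw [if_neg (by linarith [hs0 (.inl 1)]), if_neg (by linarith [hs0 (.inl 0)])]
    have h1 : ∑ _j : Fin (k ^ 2), (1 / 16 : ℝ) ≤
        ∑ j, ((k : ℝ) / 2 * (groupSum s j + C - 2) ^ 2 + groupSum s j) := by
      refine Finset.sum_le_sum fun j _ => ?_
      have : (1 : ℝ) * (groupSum s j + C - 2) ^ 2 ≤ (k : ℝ) / 2 * (groupSum s j + C - 2) ^ 2 :=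
        mul_le_mul_of_nonneg_right (by linarith) (sq_nonneg _)
      nlinarith [sq_nonneg (groupSum s j + C - 2 + 1 / 2)]
    rw [Finset.sum_add_distrib, ← Finset.mul_sum] at h1
    simp only [Finset.sum_const, Finset.card_univ, Fintype.card_fin, nsmul_eq_mul] at h1
    push_cast at h1
    have h2 : 0 ≤ 3 / 8 * (k : ℝ) ^ 3 * (C * (2 - C)) :=
      mul_nonneg (by positivity) (mul_nonneg hC0 (by linarith))
    linarith

theorem cost_lower_bound {k : ℕ} (hk : 2 ≤ k) {S : Finset ℝ}
    (φ : SignalingScheme (CenterCliqueVertex k) S) (hS : (S : Set ℝ) ⊆ Set.Icc 0 1)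
    (hφ : φ.IsPersuasive (centerCliqueGraph k)) : (k : ℝ) ^ 2 / 64 ≤ φ.cost := by
  have hf : testFun k 0 ≤ 0 := by
    have hk' : (2 : ℝ) ≤ k := by exact_mod_cast hk
    have hinv : 1 / (4 * (k : ℝ)) ≤ 1 / 8 := by
      rw [div_le_div_iff₀ (by positivity) (by norm_num)]; linarith
    rw [testFun, if_neg (by linarith)]
    norm_num
  have h1 := hφ.sum_test_nonpos hS (testFun k) hf
  have h2 : (k : ℝ) ^ 2 / 16 ≤ 4 * φ.cost +
      ∑ t : TypeProfile (CenterCliqueVertex k), prior t * ∑ s : CenterCliqueVertex k → S, φ t s *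
        ∑ v, testFun k (s v) *
          ((centerCliqueGraph k).contribution (fun v => (s v : ℝ)) v - 1) := by
    calc (k : ℝ) ^ 2 / 16
        = ∑ t : TypeProfile (CenterCliqueVertex k), prior t *
            ∑ s : CenterCliqueVertex k → S, φ t s * ((k : ℝ) ^ 2 / 16) := by
          have : ∀ t, ∑ s, φ t s = 1 := fun t => (φ t).2.2
          simp only [← Finset.sum_mul, this, SignalingScheme.sum_prior, one_mul]
      _ ≤ ∑ t : TypeProfile (CenterCliqueVertex k), prior t *
            ∑ s : CenterCliqueVertex k → S, φ t s * (4 * l1Norm (fun v => (s v : ℝ)) +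
              ∑ v, testFun k (s v) *
                ((centerCliqueGraph k).contribution (fun v => (s v : ℝ)) v - 1)) :=
          Finset.sum_le_sum fun t _ =>
            mul_le_mul_of_nonneg_left (Finset.sum_le_sum fun s _ =>
              mul_le_mul_of_nonneg_left (pointwise_bound hk _ (fun v => (hS (s v).2).1)
                (fun v => (hS (s v).2).2)) ((φ t).2.1 s)) (SignalingScheme.prior_pos t).le
      _ = _ := by
          simp only [SignalingScheme.cost, mul_add, Finset.sum_add_distrib, Finset.mul_sum]
          congr 1
          refine Finset.sum_congr rfl fun t _ => Finset.sum_congr rfl fun s _ => ?_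
          ring
  linarith

theorem card_eq (k : ℕ) : Fintype.card (CenterCliqueVertex k) = k ^ 3 + 2 := by
  simp only [Fintype.card_sum, Fintype.card_prod, Fintype.card_fin]
  ring

theorem weight_eq_half_of_isEdge {k : ℕ} (u v : CenterCliqueVertex k)
    (h : (centerCliqueGraph k).IsEdge u v) : (centerCliqueGraph k).weight u v = 1 / 2 := by
  obtain ⟨h1, h2⟩ := h
  simp only [centerCliqueGraph, if_neg h1] at h2 ⊢
  split_ifs at h2 ⊢ with h3
  · rfl
  · exact absurd h2 (lt_irrefl _)

theorem card_rpow_le {k : ℕ} (hk : 2 ≤ k) :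
    (Fintype.card (CenterCliqueVertex k) : ℝ) ^ (2 / 3 : ℝ) ≤ 2 * (k : ℝ) ^ 2 := by
  have hk' : (2 : ℝ) ≤ k := by exact_mod_cast hk
  rw [card_eq]
  push_cast
  calc ((k : ℝ) ^ 3 + 2) ^ (2 / 3 : ℝ) ≤ ((2 * (k : ℝ) ^ 2) ^ (3 / 2 : ℝ)) ^ (2 / 3 : ℝ) := by
        refine Real.rpow_le_rpow (by positivity) ?_ (by norm_num)
        rw [Real.mul_rpow (by norm_num) (by positivity), ← Real.rpow_natCast_mul (by positivity)]
        have h1 : ((2 : ℕ) : ℝ) * (3 / 2) = ((3 : ℕ) : ℝ) := by norm_num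
        rw [h1, Real.rpow_natCast]
        have h2 : (2 : ℝ) ^ (1 : ℝ) ≤ 2 ^ (3 / 2 : ℝ) :=
          Real.rpow_le_rpow_of_exponent_le (by norm_num) (by norm_num)
        rw [Real.rpow_one] at h2
        nlinarith [pow_le_pow_left₀ (by norm_num) hk' 3]
    _ = 2 * (k : ℝ) ^ 2 := by
        rw [← Real.rpow_mul (by positivity)]
        norm_num

end CenterCliqueVertex

end

theorem theorem2 :
    -- general weighted graphs
    (∃ C : ℝ, 0 < C ∧ ∀ (V : Type u) [Fintype V] [DecidableEq V] (G : WeightedGraph V),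
      G.HasPersuasiveTernaryScheme
        (C * ((Fintype.card V : ℝ) ^ (3 / 4 : ℝ) * G.optIR ^ (1 / 2 : ℝ)))) ∧
    -- edge weights bounded below by `δ`
    (∃ C : ℝ, 0 < C ∧ ∀ (V : Type u) [Fintype V] [DecidableEq V] (G : WeightedGraph V) (δ : ℝ),
      0 < δ → δ ≤ 1 → G.EdgeWeightsAtLeast δ →
      G.HasPersuasiveTernaryScheme
        (C * (((Fintype.card V : ℝ) * G.optIR) ^ (2 / 3 : ℝ) * δ ^ (-(1 / 3) : ℝ)))) ∧
    -- tightness on an explicit family with `δ = 1 / 2`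
    (∃ c : ℝ, 0 < c ∧ ∀ k : ℕ, 2 ≤ k →
      Fintype.card (CenterCliqueVertex k) = k ^ 3 + 2 ∧
      (∀ u v, (centerCliqueGraph k).IsEdge u v → (centerCliqueGraph k).weight u v = 1 / 2) ∧
      (centerCliqueGraph k).optIR = 2 ∧
      ∀ (S : Finset ℝ) (φ : SignalingScheme (CenterCliqueVertex k) S),
        (S : Set ℝ) ⊆ Set.Icc 0 1 → φ.IsPersuasive (centerCliqueGraph k) →
        c * (Fintype.card (CenterCliqueVertex k) : ℝ) ^ (2 / 3 : ℝ) ≤ φ.cost) := by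
  refine ⟨⟨16, by norm_num, ?_⟩, ⟨16, by norm_num, ?_⟩, ⟨1 / 128, by norm_num, ?_⟩⟩
  · intro V _ _ G
    rcases isEmpty_or_nonempty V with hV | hV
    · have := G.optIR_nonneg
      exact G.hasPersuasiveTernaryScheme_of_isEmpty (by positivity)
    have hn : (0 : ℝ) < Fintype.card V := by exact_mod_cast Fintype.card_pos
    have hO : 0 < G.optIR := zero_lt_one.trans_le G.one_le_optIR
    refine G.hasPersuasiveTernaryScheme_general (by positivity) ?_
    rw [mul_pow, ← Real.rpow_mul_natCast hn.le, ← Real.rpow_mul_natCast hO.le,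
      ← Real.rpow_natCast _ 3, ← Real.rpow_natCast _ 2]
    norm_num
  · intro V _ _ G δ hδ0 hδ1 hδ
    rcases isEmpty_or_nonempty V with hV | hV
    · have := G.optIR_nonneg
      exact G.hasPersuasiveTernaryScheme_of_isEmpty (by positivity)
    have hn : (0 : ℝ) < Fintype.card V := by exact_mod_cast Fintype.card_pos
    have hO : 0 < G.optIR := zero_lt_one.trans_le G.one_le_optIR
    have hnO := mul_pos hn hO
    refine G.hasPersuasiveTernaryScheme_of_edgeWeightsAtLeast (by positivity) hδ0 hδ1 hδ ?_
    rw [mul_pow, ← Real.rpow_mul_natCast hnO.le, ← Real.rpow_mul_natCast hδ0.le,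
      ← Real.rpow_natCast (_ * _) 2]
    norm_num
    rw [Real.rpow_neg_one]
    field_simp
  · intro k hk
    refine ⟨CenterCliqueVertex.card_eq k, CenterCliqueVertex.weight_eq_half_of_isEdge,
      CenterCliqueVertex.optIR_eq_two hk, fun S φ hS hφ => ?_⟩
    have h1 := CenterCliqueVertex.cost_lower_bound hk φ hS hφ
    have h2 := CenterCliqueVertex.card_rpow_le hk
    linarith
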